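/- Let $k$ be a field with algebraic closure $\bar k$. Let $\tilde G=SL_3$ and $G=\tilde G\rtimes\langle\sigma\rangle$, where $\sigma$ is the non-trivial graph automorphism $A\mapsto w\,(A^{T})^{-1}w^{-1}$ of $SL_3$, $w=\operatorname{antidiag}(1,-1,1)$; so $G^\circ=\tilde G$. Let $B$ be the Borel subgroup of upper triangular matrices of $SL_3$, regarded as a subgroup of $G$. For a cocharacter $\lambda$ of $G$ (over $\bar k$) let $P_\lambda$ be the group of all $g\in G$ such that $\lim_{a\to 0}\lambda(a)g\lambda(a)^{-1}$ exists, and $L_\lambda$ the group of all $g\in G$ for which this limit equals $g$. The groups $P_\lambda$ are the R-parabolic subgroups of $G$ (this includes $G$ itself), and $L_\lambda$ is called an R-Levi subgroup of $P_\lambda$. Let $\Lambda(G)$ be the set of $k$-defined R-parabolic subgroups of $G$, and for a closed subgroup $H$ of $G$ let $\Lambda(G)^H$ be the set of all $P\in\Lambda(G)$ containing $H$. The subgroup $H$ is $G$-completely reducible ($G$-cr) over $k$ if every $P\in\Lambda(G)^H$ has a $k$-defined R-Levi subgroup containing $H$. Let $\Delta(G)=\Delta(G^\circ)$ be the spherical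 building of $G$, whose simplices are the proper $k$-parabolic subgroups of $G^\circ=SL_3$. Then: 1. The subgroup $H=\langle\sigma,B\rangle$ of $G$ is a $k$-subgroup, it is not $G$-cr over $k$, and $\Lambda(G)^H\not\subseteq\Delta(G)$; indeed even $\Lambda(G)^H\setminus\{G\}\not\subseteq\Delta(G)$. 2. Exactly $5$ members of $\Lambda(G)$ contain $B$. Moreover, $\Lambda(G)$ ordered by reversed inclusion is not a simplicial complex, that is, it is not an ordered set in which the faces of each element (the elements below it) form an ordered set isomorphic to the set of all subsets of some set and any two elements have a greatest lower bound. -/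

import Mathlib

/-! ### Affine `k`-varieties, identified with their points over an algebraic closure `K` of `k`

An affine `k`-variety is given by its set `X` of `K`-points together with the `k`-algebra
`A` of its `k`-regular functions `X → K`. -/

section Varieties

variable {k K X Y : Type*} [Field k] [Field K] [Algebra k K]

/-- The algebra `K[X]` of all regular functions: the `K`-algebra generated by `k[X] = A`. -/
def regularFunctions (A : Subalgebra k (X → K)) : Subalgebra K (X → K) :=
  Algebra.adjoin K (A : Set (X → K))

/-- Morphisms of varieties over `K`: regular functions pull back to regular functions. -/
def IsMorphism (A : Subalgebra k (X → K)) (B : Subalgebra k (Y → K)) (φ : X → Y) : Prop :=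
  ∀ f ∈ regularFunctions B, f ∘ φ ∈ regularFunctions A

/-- Zariski-closed subsets: the zero loci of sets of regular functions. -/
def IsZariskiClosed (A : Subalgebra k (X → K)) (Z : Set X) : Prop :=
  ∃ S : Set (X → K), S ⊆ regularFunctions A ∧ Z = {x | ∀ f ∈ S, f x = 0}

/-- A closed subset `Z` is `k`-defined if its vanishing ideal in `K[X]` is spanned over `K` by the
elements of `k[X]` that vanish on `Z`. -/
def IsDefinedOver (A : Subalgebra k (X → K)) (Z : Set X) : Prop :=
  IsZariskiClosed A Z ∧
    ∀ f ∈ regularFunctions A, (∀ x ∈ Z, f x = 0) →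
      f ∈ Submodule.span K {h : X → K | h ∈ A ∧ ∀ x ∈ Z, h x = 0}

variable (k K) in
/-- The affine line: `k[t]` as functions on `K`. -/
def affineLine : Subalgebra k (K → K) :=
  Algebra.adjoin k {fun t : K => t}

variable (k K) in
/-- The multiplicative group: `k[t, t⁻¹]` as functions on `Kˣ`. -/
def multiplicativeGroup : Subalgebra k (Kˣ → K) :=
  Algebra.adjoin k {fun t : Kˣ => (t : K), fun t : Kˣ => ((t⁻¹ : Kˣ) : K)}

/-- `lim_{a → 0} φ(a)` exists and equals `x`: the map `φ` on `Kˣ` extends to a morphism from the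
affine line that takes the value `x` at `0`. -/
def HasLimitAtZero (A : Subalgebra k (X → K)) (φ : Kˣ → X) (x : X) : Prop :=
  ∃ ψ : K → X, IsMorphism (affineLine k K) A ψ ∧ (∀ a : Kˣ, ψ (a : K) = φ a) ∧ ψ 0 = x

end Varieties

/-! ### R-parabolic subgroups, R-Levi subgroups, complete reducibility over `k` -/

section Groups

variable {k K Γ : Type*} [Field k] [Field K] [Algebra k K] [Group Γ]

/-- Cocharacters (over `K`) of the algebraic group `Γ` with algebra `A` of `k`-regular functions. -/
def IsCocharacter (A : Subalgebra k (Γ → K)) (l : Kˣ →* Γ) : Prop :=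
  IsMorphism (multiplicativeGroup k K) A l

/-- `P_λ`: the elements `g` for which `lim_{a → 0} λ(a) g λ(a)⁻¹` exists. -/
def parabolicSet (A : Subalgebra k (Γ → K)) (l : Kˣ →* Γ) : Set Γ :=
  {g | ∃ x, HasLimitAtZero A (fun a => l a * g * (l a)⁻¹) x}

/-- `L_λ`: the elements `g` for which `lim_{a → 0} λ(a) g λ(a)⁻¹ = g`. -/
def leviSet (A : Subalgebra k (Γ → K)) (l : Kˣ →* Γ) : Set Γ :=
  {g | HasLimitAtZero A (fun a => l a * g * (l a)⁻¹) g}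

/-- `P` is an R-parabolic subgroup, that is `P = P_λ` for some cocharacter `λ`. -/
def IsRParabolic (A : Subalgebra k (Γ → K)) (P : Subgroup Γ) : Prop :=
  ∃ l : Kˣ →* Γ, IsCocharacter A l ∧ (P : Set Γ) = parabolicSet A l

/-- `L` is an R-Levi subgroup of `P`, that is `P = P_λ` and `L = L_λ` for some cocharacter `λ`. -/
def IsRLevi (A : Subalgebra k (Γ → K)) (P L : Subgroup Γ) : Prop :=
  ∃ l : Kˣ →* Γ, IsCocharacter A l ∧ (P : Set Γ) = parabolicSet A l ∧ (L : Set Γ) = leviSet A l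

/-- `Λ(Γ)`: the set of `k`-defined R-parabolic subgroups (including `Γ` itself). -/
def kRParabolics (A : Subalgebra k (Γ → K)) : Set (Subgroup Γ) :=
  {P | IsRParabolic A P ∧ IsDefinedOver A (P : Set Γ)}

/-- `Λ(Γ)^H`: the `k`-defined R-parabolic subgroups containing `H`. -/
def kRParabolicsOver (A : Subalgebra k (Γ → K)) (H : Subgroup Γ) : Set (Subgroup Γ) :=
  {P | P ∈ kRParabolics A ∧ H ≤ P}

/-- `H` is `Γ`-completely reducible over `k`: every `k`-defined R-parabolic subgroup `P`
containing `H` has a `k`-defined R-Levi subgroup containing `H`. -/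
def IsCompletelyReducibleOver (A : Subalgebra k (Γ → K)) (H : Subgroup Γ) : Prop :=
  ∀ P ∈ kRParabolics A, H ≤ P →
    ∃ L : Subgroup Γ, IsRLevi A P L ∧ IsDefinedOver A (L : Set Γ) ∧ H ≤ L

end Groups

/-- Simplicial complexes as ordered sets (`a ≤ b` means that `a` is a face of `b`; the empty
simplex is included): the faces of each element form an ordered set isomorphic to the set of all
subsets of some set, and any two elements have a greatest lower bound. -/
def IsSimplicialComplex.{u} (X : Type u) [PartialOrder X] : Prop :=
  (∀ a : X, ∃ V : Type u, Nonempty (Set.Iic a ≃o Set V)) ∧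
    ∀ a b : X, ∃ c : X, IsGLB {a, b} c

/-! ### The group `SL₃ ⋊ ⟨σ⟩` -/

section GraphAutomorphism

open Matrix

variable (k K : Type*) [Field k] [Field K] [Algebra k K]

/-- The representative `antidiag(1, -1, 1)` of the longest element of the Weyl group. -/
def longestElement : Matrix.SpecialLinearGroup (Fin 3) K :=
  ⟨!![0, 0, 1; 0, -1, 0; 1, 0, 0], by simp [det_fin_three]⟩

theorem coe_longestElement :
    (longestElement K : Matrix (Fin 3) (Fin 3) K) = !![0, 0, 1; 0, -1, 0; 1, 0, 0] := rfl

/-- The map `A ↦ w (Aᵀ)⁻¹ w⁻¹`, where `w = antidiag(1, -1, 1)`. -/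
def graphMap (A : Matrix.SpecialLinearGroup (Fin 3) K) : Matrix.SpecialLinearGroup (Fin 3) K :=
  longestElement K * (A.transpose)⁻¹ * (longestElement K)⁻¹

variable {K} in
theorem graphMap_mul (A B : Matrix.SpecialLinearGroup (Fin 3) K) :
    graphMap K (A * B) = graphMap K A * graphMap K B := by
  have h : (A * B).transpose = B.transpose * A.transpose := by
    ext i j
    simp [Matrix.mul_apply, mul_comm]
  simp [graphMap, h, mul_assoc]

variable {K} in
theorem graphMap_graphMap (A : Matrix.SpecialLinearGroup (Fin 3) K) :
    graphMap K (graphMap K A) = A := by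
  have hmul : ∀ X Y : Matrix.SpecialLinearGroup (Fin 3) K,
      (X * Y).transpose = Y.transpose * X.transpose := by
    intro X Y
    ext i j
    simp [Matrix.mul_apply, mul_comm]
  have hinv : ∀ X : Matrix.SpecialLinearGroup (Fin 3) K, (X⁻¹).transpose = (X.transpose)⁻¹ := by
    intro X
    rw [eq_inv_iff_mul_eq_one, ← hmul, mul_inv_cancel]
    ext i j
    simp [Matrix.one_apply, eq_comm]
  have hw : (longestElement K).transpose = longestElement K := by
    ext i j
    rw [Matrix.SpecialLinearGroup.coe_transpose, coe_longestElement]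
    fin_cases i <;> fin_cases j <;> simp
  have hww : longestElement K * longestElement K = 1 := by
    apply Matrix.SpecialLinearGroup.ext
    intro i j
    rw [Matrix.SpecialLinearGroup.coe_mul, coe_longestElement]
    fin_cases i <;> fin_cases j <;> simp [Matrix.mul_apply, Fin.sum_univ_three]
  have hw' : (longestElement K)⁻¹ = longestElement K := inv_eq_of_mul_eq_one_left hww
  have htt : A.transpose.transpose = A := by
    ext i j
    simp
  simp only [graphMap, hmul, hinv, hw, hw', htt, _root_.mul_inv_rev, inv_inv]
  have hww' : ∀ X : Matrix.SpecialLinearGroup (Fin 3) K, longestElement K * (longestElement K * X) = X := by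
    intro X
    rw [← mul_assoc, hww, one_mul]
  simp only [mul_assoc, hww, hww', mul_one]

/-- The non-trivial graph automorphism `σ` of `SL₃` (it preserves the diagonal torus and the upper
triangular Borel subgroup, interchanges the two simple roots, and preserves the standard pinning). -/
def graphAutomorphism : MulAut (Matrix.SpecialLinearGroup (Fin 3) K) where
  toFun := graphMap K
  invFun := graphMap K
  left_inv := graphMap_graphMap
  right_inv := graphMap_graphMap
  map_mul' := graphMap_mul

/-- `G = SL₃ ⋊ ⟨σ⟩` (its `K`-points). -/
abbrev ExtendedSL3 : Type _ :=
  Matrix.SpecialLinearGroup (Fin 3) K ⋊[(Subgroup.zpowers (graphAutomorphism K)).subtype]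
    (Subgroup.zpowers (graphAutomorphism K))

/-- `σ` as an element of `G`. -/
def sigma : ExtendedSL3 K :=
  SemidirectProduct.inr ⟨graphAutomorphism K, Subgroup.mem_zpowers _⟩

/-- `k[SL₃]`: generated by the matrix entries. -/
def coordinateRingSL3 : Subalgebra k (Matrix.SpecialLinearGroup (Fin 3) K → K) :=
  Algebra.adjoin k {f | ∃ i j : Fin 3,
    f = fun g : Matrix.SpecialLinearGroup (Fin 3) K => (g : Matrix (Fin 3) (Fin 3) K) i j}

open Classical in
/-- `k[G]`: as a variety, `G` is the product of `SL₃` with the finite constant group `⟨σ⟩`; its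
coordinate ring is generated by the matrix entries and the indicator functions of the
elements of `⟨σ⟩`. -/
noncomputable def coordinateRing : Subalgebra k (ExtendedSL3 K → K) :=
  Algebra.adjoin k
    ({f | ∃ i j : Fin 3,
        f = fun g : ExtendedSL3 K => (g.left : Matrix (Fin 3) (Fin 3) K) i j} ∪
      {f | ∃ s : Subgroup.zpowers (graphAutomorphism K),
        f = fun g : ExtendedSL3 K => if g.right = s then 1 else 0})

/-- The Borel subgroup of upper triangular matrices in `SL₃`. -/
def borelSL3 : Subgroup (Matrix.SpecialLinearGroup (Fin 3) K) where
  carrier := {g | ∀ i j : Fin 3, j < i → (g : Matrix (Fin 3) (Fin 3) K) i j = 0}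
  one_mem' := by
    intro i j h
    simp [h.ne']
  mul_mem' := by
    intro a b ha hb
    have ha' : (a : Matrix (Fin 3) (Fin 3) K).BlockTriangular id := fun i j h => ha i j h
    have hb' : (b : Matrix (Fin 3) (Fin 3) K).BlockTriangular id := fun i j h => hb i j h
    intro i j h
    exact (ha'.mul hb') h
  inv_mem' := by
    intro a ha
    have h10 := ha 1 0 (by decide)
    have h20 := ha 2 0 (by decide)
    have h21 := ha 2 1 (by decide)
    intro i j h
    fin_cases i <;> fin_cases j <;>
      simp_all [adjugate_fin_three]

/-- The Borel subgroup `B` as a subgroup of `G`. -/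
def borelSubgroup : Subgroup (ExtendedSL3 K) :=
  (borelSL3 K).map SemidirectProduct.inl

/-- The simplices of the spherical building `Δ(G) = Δ(G°)`, `G° = SL₃`: the proper `k`-parabolic
subgroups of `SL₃` (for this connected group the same as the `k`-defined R-parabolic ones),
regarded as subgroups of `G`. -/
def building : Set (Subgroup (ExtendedSL3 K)) :=
  {P | ∃ Q ∈ kRParabolics (coordinateRingSL3 k K), Q ≠ ⊤ ∧ P = Q.map SemidirectProduct.inl}

end GraphAutomorphism

/-! Any subgroup between `B` and `G` is one of six. Row and column operations show that the
overgroups of `B` in `SL₃` are `B`, the two maximal parabolics `lineStabilizer` and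
`planeStabilizer`, and `SL₃` (`eq_of_borelSL3_le`). If such a subgroup of `G` meets the outer coset,
its intersection with `SL₃` is stable under some `g σ`. Since `σ` interchanges the two maximal
parabolics, which are not conjugate, and `B` is self-normalizing, only `⟨σ, B⟩` and `G` are added
(`eq_of_borelSubgroup_le`).

Five of the six are R-parabolic, through explicit diagonal cocharacters `diag(a ^ n₀, a ^ n₁, a ^
n₂)`. The outer coset meets `P_λ` when `σ` fixes `λ`, as for the weights `(1, 0, -1)` giving `⟨σ,
B⟩`, and misses it for the other nontrivial weights used. The exception is `SL₃`: a cocharacter with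
`SL₃ ⊆ P_λ` is central, hence trivial, and then `P_λ = G` (`not_isRParabolic_SL3`).

Fields of definition come from parametrizing each subgroup, coset by coset, by a principal open
subset of affine space over `k` (`isLinearlyDisjointOn_range`).

The conclusions follow. An R-Levi subgroup containing `B` comes from a cocharacter centralizing `B`,
which is trivial, so the proper R-parabolic subgroup `⟨σ, B⟩` contains itself but has no R-Levi
subgroup containing it. It also contains `σ`, so it is not a simplex of the building. Finally the
faces of `B` in the reversed order are the five overgroups, and five is not the cardinality of a
power set. -/

/-! ### Overgroups of the Borel subgroup in `SL₃`. -/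

section SubgroupsOfSL3

open Matrix

variable {F : Type*} [Field F]

/-- The upper triangular matrix with rows `(a, x, y)`, `(0, b, z)`, `(0, 0, c)`. -/
def upperSL3 (a b c x y z : F) (h : a * b * c = 1) : SpecialLinearGroup (Fin 3) F :=
  ⟨!![a, x, y; 0, b, z; 0, 0, c], by simp [det_fin_three, h]⟩

theorem coe_upperSL3 (a b c x y z : F) (h : a * b * c = 1) :
    (upperSL3 a b c x y z h : Matrix (Fin 3) (Fin 3) F) = !![a, x, y; 0, b, z; 0, 0, c] := rfl

/-- The lower triangular matrix with rows `(1, 0, 0)`, `(x, 1, 0)`, `(0, z, 1)`. -/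
def lowerSL3 (x z : F) : SpecialLinearGroup (Fin 3) F :=
  ⟨!![1, 0, 0; x, 1, 0; 0, z, 1], by simp [det_fin_three]⟩

theorem coe_lowerSL3 (x z : F) :
    (lowerSL3 x z : Matrix (Fin 3) (Fin 3) F) = !![1, 0, 0; x, 1, 0; 0, z, 1] := rfl

theorem mem_borelSL3_iff {g : SpecialLinearGroup (Fin 3) F} :
    g ∈ borelSL3 F ↔ g 1 0 = 0 ∧ g 2 0 = 0 ∧ g 2 1 = 0 := by
  constructor
  · intro h
    exact ⟨h 1 0 (by decide), h 2 0 (by decide), h 2 1 (by decide)⟩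
  · rintro ⟨h1, h2, h3⟩ i j hij
    fin_cases i <;> fin_cases j <;> first | exact absurd hij (by decide) | assumption

theorem upperSL3_mem (a b c x y z : F) (h : a * b * c = 1) :
    upperSL3 a b c x y z h ∈ borelSL3 F := by
  simp [mem_borelSL3_iff, coe_upperSL3]

theorem SL3_mul_apply (g h : SpecialLinearGroup (Fin 3) F) (i j : Fin 3) :
    (g * h) i j = g i 0 * h 0 j + g i 1 * h 1 j + g i 2 * h 2 j := by
  simp [mul_apply, Fin.sum_univ_three]

variable (F) in
/-- The stabilizer in `SL₃` of the line spanned by the first standard basis vector. -/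
def lineStabilizer : Subgroup (SpecialLinearGroup (Fin 3) F) where
  carrier := {g | g 1 0 = 0 ∧ g 2 0 = 0}
  one_mem' := by simp
  mul_mem' := by
    rintro a b ⟨ha, ha'⟩ ⟨hb, hb'⟩
    simp [SL3_mul_apply, ha, ha', hb, hb']
  inv_mem' := by
    rintro a ⟨ha, ha'⟩
    simp [adjugate_fin_three, ha, ha']

variable (F) in
/-- The stabilizer in `SL₃` of the plane spanned by the first two standard basis vectors. -/
def planeStabilizer : Subgroup (SpecialLinearGroup (Fin 3) F) where
  carrier := {g | g 2 0 = 0 ∧ g 2 1 = 0}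
  one_mem' := by simp
  mul_mem' := by
    rintro a b ⟨ha, ha'⟩ ⟨hb, hb'⟩
    simp [SL3_mul_apply, ha, ha', hb, hb']
  inv_mem' := by
    rintro a ⟨ha, ha'⟩
    simp [adjugate_fin_three, ha, ha']

theorem mem_lineStabilizer_iff {g : SpecialLinearGroup (Fin 3) F} :
    g ∈ lineStabilizer F ↔ g 1 0 = 0 ∧ g 2 0 = 0 := Iff.rfl

theorem mem_planeStabilizer_iff {g : SpecialLinearGroup (Fin 3) F} :
    g ∈ planeStabilizer F ↔ g 2 0 = 0 ∧ g 2 1 = 0 := Iff.rfl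

theorem borelSL3_le_lineStabilizer : borelSL3 F ≤ lineStabilizer F :=
  fun _ h => ⟨(mem_borelSL3_iff.1 h).1, (mem_borelSL3_iff.1 h).2.1⟩

theorem borelSL3_le_planeStabilizer : borelSL3 F ≤ planeStabilizer F :=
  fun _ h => (mem_borelSL3_iff.1 h).2

theorem mem_borelSL3_of_mem_of_mem {g : SpecialLinearGroup (Fin 3) F}
    (h1 : g ∈ lineStabilizer F) (h2 : g ∈ planeStabilizer F) : g ∈ borelSL3 F :=
  mem_borelSL3_iff.2 ⟨h1.1, h2⟩

/-- If `h` and `g` have the same first column, then `g⁻¹ h` fixes the first basis vector. -/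
theorem inv_mul_mem_lineStabilizer {g h : SpecialLinearGroup (Fin 3) F}
    (e : ∀ i, h i 0 = g i 0) : g⁻¹ * h ∈ lineStabilizer F := by
  have key : ∀ i, (g⁻¹ * h) i 0 = (g⁻¹ * g) i 0 := by
    intro i
    simp only [SL3_mul_apply, e]
  rw [mem_lineStabilizer_iff, key, key]
  simp

/-- If `h` and `g` have the same last row, then `h g⁻¹` stabilizes the standard plane. -/
theorem mul_inv_mem_planeStabilizer {g h : SpecialLinearGroup (Fin 3) F}
    (e : ∀ i, h 2 i = g 2 i) : h * g⁻¹ ∈ planeStabilizer F := by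
  have key : ∀ i, (h * g⁻¹) 2 i = (g * g⁻¹) 2 i := by
    intro i
    simp only [SL3_mul_apply, e]
  rw [mem_planeStabilizer_iff, key, key]
  simp

variable {Q : Subgroup (SpecialLinearGroup (Fin 3) F)}

/-- A rank-one Bruhat decomposition: `planeStabilizer` is `B ∪ B g B`. When `h 1 0 ≠ 0`, an upper
triangular `b` makes the first columns of `b h` and `g` agree, and then `g⁻¹ b h` lies in both
maximal parabolics, hence in `B`. -/
theorem planeStabilizer_le_of_mem (hQ : borelSL3 F ≤ Q) {g : SpecialLinearGroup (Fin 3) F}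
    (hg : g ∈ Q) (hgP : g ∈ planeStabilizer F) (h10 : g 1 0 ≠ 0) : planeStabilizer F ≤ Q := by
  intro h hh
  by_cases hh10 : h 1 0 = 0
  · exact hQ (mem_borelSL3_iff.2 ⟨hh10, hh⟩)
  · have hdet : 1 * (g 1 0 / h 1 0) * (h 1 0 / g 1 0) = 1 := by field_simp
    set b := upperSL3 1 (g 1 0 / h 1 0) (h 1 0 / g 1 0) ((g 0 0 - h 0 0) / h 1 0) 0 0 hdet with hb
    have hbB : b ∈ borelSL3 F := upperSL3_mem _ _ _ _ _ _ _
    have hl : g⁻¹ * (b * h) ∈ lineStabilizer F := by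
      apply inv_mul_mem_lineStabilizer
      intro i
      rw [SL3_mul_apply, hb, coe_upperSL3]
      fin_cases i
      · simp; field_simp; ring
      · simp; field_simp
      · simp [hh.1, hgP.1]
    have hp : g⁻¹ * (b * h) ∈ planeStabilizer F :=
      mul_mem (inv_mem hgP) (mul_mem (borelSL3_le_planeStabilizer hbB) hh)
    have := mul_mem (inv_mem (hQ hbB)) (mul_mem hg (hQ (mem_borelSL3_of_mem_of_mem hl hp)))
    simpa using this

/-- The dual argument, multiplying on the right by `b` to match last rows instead of first columns.
-/
theorem lineStabilizer_le_of_mem (hQ : borelSL3 F ≤ Q) {g : SpecialLinearGroup (Fin 3) F}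
    (hg : g ∈ Q) (hgL : g ∈ lineStabilizer F) (h21 : g 2 1 ≠ 0) : lineStabilizer F ≤ Q := by
  intro h hh
  by_cases hh21 : h 2 1 = 0
  · exact hQ (mem_borelSL3_iff.2 ⟨hh.1, hh.2, hh21⟩)
  · have hdet : (h 2 1 / g 2 1) * (g 2 1 / h 2 1) * 1 = 1 := by field_simp
    set b := upperSL3 (h 2 1 / g 2 1) (g 2 1 / h 2 1) 1 0 0 ((g 2 2 - h 2 2) / h 2 1) hdet with hb
    have hbB : b ∈ borelSL3 F := upperSL3_mem _ _ _ _ _ _ _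
    have hp : (h * b) * g⁻¹ ∈ planeStabilizer F := by
      apply mul_inv_mem_planeStabilizer
      intro i
      rw [SL3_mul_apply, hb, coe_upperSL3]
      fin_cases i
      · simp [hh.2, hgL.2]
      · simp [hh.2]; field_simp
      · simp [hh.2]; field_simp; ring
    have hl : (h * b) * g⁻¹ ∈ lineStabilizer F :=
      mul_mem (mul_mem hh (borelSL3_le_lineStabilizer hbB)) (inv_mem hgL)
    have := mul_mem (mul_mem (hQ (mem_borelSL3_of_mem_of_mem hl hp)) hg) (inv_mem (hQ hbB))
    simpa using this

/-- Supplies the element with which `eq_top_of_mem` builds a member of `lineStabilizer` outside `B`;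
that construction needs a nonzero corner in the inverse as well. -/
theorem exists_mem_inv_ne_zero (hQ : borelSL3 F ≤ Q) {g : SpecialLinearGroup (Fin 3) F}
    (hg : g ∈ Q) (h20 : g 2 0 ≠ 0) : ∃ h ∈ Q, h 2 0 ≠ 0 ∧ h⁻¹ 2 0 ≠ 0 := by
  by_cases hu : g⁻¹ 2 0 = 0
  · have hu10 : g⁻¹ 1 0 ≠ 0 := fun h => h20 (by
      simpa using ((inv_mem_iff (H := lineStabilizer F) (x := g)).1 ⟨h, hu⟩).2)
    have hu21 : g⁻¹ 2 1 ≠ 0 := fun h => h20 (by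
      simpa using ((inv_mem_iff (H := planeStabilizer F) (x := g)).1 ⟨hu, h⟩).1)
    have hdet : (1 : F) * 1 * 1 = 1 := by ring
    -- This value of `y` makes the lower left entry of `g b g` equal to `1`.
    set y := (1 - (g * g) 2 0) / (g 2 0 * g 2 0) with hy
    set b := upperSL3 1 1 1 0 y 0 hdet with hb
    have hbQ : b ∈ Q := hQ (upperSL3_mem _ _ _ _ _ _ _)
    have hbi : b⁻¹ = upperSL3 1 1 1 0 (-y) 0 hdet := by
      rw [inv_eq_iff_mul_eq_one]
      ext i j
      rw [SL3_mul_apply, hb, coe_upperSL3, coe_upperSL3]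
      fin_cases i <;> fin_cases j <;> simp
    refine ⟨g⁻¹ * b⁻¹ * g⁻¹, mul_mem (mul_mem (inv_mem hg) (inv_mem hbQ)) (inv_mem hg), ?_, ?_⟩
    · rw [SL3_mul_apply, SL3_mul_apply, SL3_mul_apply, SL3_mul_apply, hbi, coe_upperSL3, hu]
      simpa using ⟨hu21, hu10⟩
    · have e : (g⁻¹ * b⁻¹ * g⁻¹)⁻¹ = g * (b * g) := by group
      have e' : (g * (b * g)) 2 0 = 1 := by
        have : (g * g) 2 0 + y * (g 2 0 * g 2 0) = 1 := by
          rw [hy]; field_simp; ring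
        rw [SL3_mul_apply] at this
        rw [SL3_mul_apply, SL3_mul_apply, SL3_mul_apply, SL3_mul_apply, hb, coe_upperSL3]
        simp
        linear_combination this
      rw [e, e']
      exact one_ne_zero
  · exact ⟨g, hg, h20, hu⟩

theorem eq_top_of_mem (hQ : borelSL3 F ≤ Q) {g : SpecialLinearGroup (Fin 3) F}
    (hg : g ∈ Q) (h20 : g 2 0 ≠ 0) : Q = ⊤ := by
  have hline : lineStabilizer F ≤ Q := by
    obtain ⟨g, hg, h20, hi⟩ := exists_mem_inv_ne_zero hQ hg h20
    have hdet : (1 : F) * 1 * 1 = 1 := by ring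
    -- The row `(0, g 2 0, -g 1 0)` annihilates the first column of `g`, so `b` fixes that column
    -- and `g⁻¹ b g` fixes the first basis vector.
    set b := upperSL3 1 1 1 (g 2 0) (-g 1 0) 0 hdet with hb
    have hq : g⁻¹ * (b * g) ∈ lineStabilizer F := by
      apply inv_mul_mem_lineStabilizer
      intro i
      rw [SL3_mul_apply, hb, coe_upperSL3]
      fin_cases i <;> simp
      ring
    refine lineStabilizer_le_of_mem hQ
      (mul_mem (inv_mem hg) (mul_mem (hQ (upperSL3_mem _ _ _ _ _ _ _)) hg)) hq ?_
    have key : (g⁻¹ * (b * g)) 2 1 = - (g⁻¹ 2 0 * g⁻¹ 2 0) := by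
      rw [SL3_mul_apply, SL3_mul_apply, SL3_mul_apply, SL3_mul_apply, hb, coe_upperSL3]
      simp [adjugate_fin_three]
      ring
    rw [key]
    exact neg_ne_zero.2 (mul_ne_zero hi hi)
  have hbig : ∀ h : SpecialLinearGroup (Fin 3) F, h 2 0 ≠ 0 → h ∈ Q := by
    intro h hh
    have hdet : (h 2 0 / g 2 0) * 1 * (g 2 0 / h 2 0) = 1 := by field_simp
    set b := upperSL3 (h 2 0 / g 2 0) 1 (g 2 0 / h 2 0) 0 ((g 0 0 - h 2 0 / g 2 0 * h 0 0) / h 2 0)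
      ((g 1 0 - h 1 0) / h 2 0) hdet with hb
    have hbB : b ∈ borelSL3 F := upperSL3_mem _ _ _ _ _ _ _
    have hl : g⁻¹ * (b * h) ∈ lineStabilizer F := by
      apply inv_mul_mem_lineStabilizer
      intro i
      rw [SL3_mul_apply, hb, coe_upperSL3]
      fin_cases i
      · simp; field_simp; ring
      · simp; field_simp; ring
      · simp; field_simp
    have := mul_mem (inv_mem (hQ hbB)) (mul_mem hg (hline hl))
    simpa using this
  rw [eq_top_iff]
  intro h _
  by_cases hh : h 2 0 = 0
  · by_cases h10 : h 1 0 = 0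
    · exact hline ⟨h10, hh⟩
    -- Adding the second row to the third moves the nonzero entry `h 1 0` into the corner, which
    -- reduces to `hbig`.
    · have ht : lowerSL3 0 1 ∈ Q := hline (by simp [mem_lineStabilizer_iff, coe_lowerSL3])
      have := mul_mem (inv_mem ht) (hbig (lowerSL3 0 1 * h) (by
        rw [SL3_mul_apply, coe_lowerSL3]
        simpa [hh] using h10))
      simpa using this
  · exact hbig h hh

/-- The subgroups of `SL₃` containing the upper triangular Borel subgroup. -/
theorem eq_of_borelSL3_le (hQ : borelSL3 F ≤ Q) :
    Q = borelSL3 F ∨ Q = lineStabilizer F ∨ Q = planeStabilizer F ∨ Q = ⊤ := by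
  by_cases h20 : ∃ g ∈ Q, g 2 0 ≠ 0
  · obtain ⟨g, hg, h⟩ := h20
    exact Or.inr (Or.inr (Or.inr (eq_top_of_mem hQ hg h)))
  push Not at h20
  by_cases h21 : ∃ h ∈ Q, h 2 1 ≠ 0
  · obtain ⟨h, hh, hh21⟩ := h21
    have hle : Q ≤ lineStabilizer F := by
      intro g hg
      -- As all corners in `Q` vanish, the corner of `h g` is `h 2 1 * g 1 0`, which forces `g 1 0 =
      -- 0`.
      have := h20 _ (mul_mem hh hg)
      rw [SL3_mul_apply, h20 _ hh, h20 _ hg] at this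
      refine ⟨?_, h20 g hg⟩
      simpa [hh21] using this
    exact Or.inr (Or.inl (le_antisymm hle (lineStabilizer_le_of_mem hQ hh (hle hh) hh21)))
  push Not at h21
  have hle : Q ≤ planeStabilizer F := fun g hg => ⟨h20 g hg, h21 g hg⟩
  by_cases h10 : ∃ g ∈ Q, g 1 0 ≠ 0
  · obtain ⟨g, hg, h⟩ := h10
    exact Or.inr (Or.inr (Or.inl (le_antisymm hle (planeStabilizer_le_of_mem hQ hg (hle hg) h))))
  push Not at h10
  exact Or.inl (le_antisymm
    (fun g hg => mem_borelSL3_iff.2 ⟨h10 g hg, h20 g hg, h21 g hg⟩) hQ)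

end SubgroupsOfSL3

/-! ### Overgroups of the Borel subgroup in `SL₃ ⋊ ⟨σ⟩`. -/

section SubgroupsOfExtendedSL3

open Matrix

variable {K : Type*} [Field K]

theorem longestElement_inv : (longestElement K)⁻¹ = longestElement K := by
  rw [inv_eq_iff_mul_eq_one]
  ext i j
  rw [SL3_mul_apply, coe_longestElement]
  fin_cases i <;> fin_cases j <;> simp

/-- For determinant one, `(Aᵀ)⁻¹` is the cofactor matrix; conjugation by `w` reverses both indices,
and the signs of `w` cancel those of the cofactors, leaving plain minors. -/
theorem coe_graphMap (g : SpecialLinearGroup (Fin 3) K) :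
    (graphMap K g : Matrix (Fin 3) (Fin 3) K) =
      !![g 0 0 * g 1 1 - g 0 1 * g 1 0, g 0 0 * g 1 2 - g 0 2 * g 1 0,
          g 0 1 * g 1 2 - g 0 2 * g 1 1;
        g 0 0 * g 2 1 - g 0 1 * g 2 0, g 0 0 * g 2 2 - g 0 2 * g 2 0,
          g 0 1 * g 2 2 - g 0 2 * g 2 1;
        g 1 0 * g 2 1 - g 1 1 * g 2 0, g 1 0 * g 2 2 - g 1 2 * g 2 0,
          g 1 1 * g 2 2 - g 1 2 * g 2 1] := by
  ext i j
  rw [graphMap, longestElement_inv, SL3_mul_apply, SL3_mul_apply, SL3_mul_apply, SL3_mul_apply,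
    coe_longestElement]
  fin_cases i <;> fin_cases j <;> simp [adjugate_fin_three] <;> ring

theorem graphMap_mem_planeStabilizer {g : SpecialLinearGroup (Fin 3) K}
    (h : g ∈ lineStabilizer K) : graphMap K g ∈ planeStabilizer K := by
  rw [mem_planeStabilizer_iff, coe_graphMap]
  simp [h.1, h.2]

theorem graphMap_mem_lineStabilizer {g : SpecialLinearGroup (Fin 3) K}
    (h : g ∈ planeStabilizer K) : graphMap K g ∈ lineStabilizer K := by
  rw [mem_lineStabilizer_iff, coe_graphMap]
  simp [h.1, h.2]

theorem graphMap_mem_borelSL3 {g : SpecialLinearGroup (Fin 3) K}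
    (h : g ∈ borelSL3 K) : graphMap K g ∈ borelSL3 K :=
  mem_borelSL3_of_mem_of_mem
    (graphMap_mem_lineStabilizer (borelSL3_le_planeStabilizer h))
    (graphMap_mem_planeStabilizer (borelSL3_le_lineStabilizer h))

theorem graphAutomorphism_apply (g : SpecialLinearGroup (Fin 3) K) :
    graphAutomorphism K g = graphMap K g := rfl

theorem graphAutomorphism_mul_self : graphAutomorphism K * graphAutomorphism K = 1 := by
  ext1 g
  exact graphMap_graphMap g

theorem graphAutomorphism_ne_one : graphAutomorphism K ≠ 1 := by
  intro h
  have h1 : graphMap K (lowerSL3 1 0) = lowerSL3 1 0 := by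
    rw [← graphAutomorphism_apply, h, MulAut.one_apply]
  have h2 := congrArg (fun g : SpecialLinearGroup (Fin 3) K => g 1 0) h1
  simp only [coe_graphMap, coe_lowerSL3] at h2
  simp at h2

variable (K) in
/-- `σ` as an element of `⟨σ⟩`. -/
def graphElement : Subgroup.zpowers (graphAutomorphism K) :=
  ⟨graphAutomorphism K, Subgroup.mem_zpowers _⟩

theorem graphElement_ne_one : graphElement K ≠ 1 :=
  fun h => graphAutomorphism_ne_one (congrArg Subtype.val h)

theorem graphElement_mul_self : graphElement K * graphElement K = 1 :=
  Subtype.ext graphAutomorphism_mul_self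

theorem graphElement_inv : (graphElement K)⁻¹ = graphElement K :=
  inv_eq_iff_mul_eq_one.2 graphElement_mul_self

theorem eq_one_or_eq_graphElement (s : Subgroup.zpowers (graphAutomorphism K)) :
    s = 1 ∨ s = graphElement K := by
  obtain ⟨s, n, rfl⟩ := s
  obtain ⟨m, rfl | rfl⟩ := Int.even_or_odd' n
  · left
    apply Subtype.ext
    simp [_root_.zpow_mul, pow_two, graphAutomorphism_mul_self]
  · right
    apply Subtype.ext
    simp [_root_.zpow_add, _root_.zpow_mul, pow_two, graphAutomorphism_mul_self, graphElement]

theorem mul_self_eq_one (s : Subgroup.zpowers (graphAutomorphism K)) : s * s = 1 := by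
  rcases eq_one_or_eq_graphElement s with rfl | rfl
  · simp
  · exact graphElement_mul_self

/-- The subgroup of the elements `g s` of `SL₃ ⋊ ⟨σ⟩` with `g` upper triangular. -/
def extendedBorel (K : Type*) [Field K] : Subgroup (ExtendedSL3 K) where
  carrier := {x | x.left ∈ borelSL3 K}
  one_mem' := one_mem (borelSL3 K)
  mul_mem' := by
    intro x y hx hy
    refine mul_mem (show x.left ∈ borelSL3 K from hx) ?_
    rcases eq_one_or_eq_graphElement x.right with h | h <;> rw [h]
    · exact hy
    · exact graphMap_mem_borelSL3 hy
  inv_mem' := by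
    intro x hx
    change (x⁻¹).left ∈ borelSL3 K
    rw [SemidirectProduct.inv_left]
    rcases eq_one_or_eq_graphElement x.right with h | h <;> rw [h]
    · simpa using hx
    · rw [graphElement_inv]
      exact graphMap_mem_borelSL3 (inv_mem hx)

theorem mem_extendedBorel_iff {x : ExtendedSL3 K} :
    x ∈ extendedBorel K ↔ x.left ∈ borelSL3 K := Iff.rfl

theorem mem_map_inl_iff {Q : Subgroup (SpecialLinearGroup (Fin 3) K)} {x : ExtendedSL3 K} :
    x ∈ Q.map SemidirectProduct.inl ↔ x.right = 1 ∧ x.left ∈ Q := by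
  constructor
  · rintro ⟨g, hg, rfl⟩
    exact ⟨rfl, hg⟩
  · rintro ⟨h1, h2⟩
    exact ⟨x.left, h2, SemidirectProduct.ext rfl h1.symm⟩

theorem inl_left_mul_inr_right (x : ExtendedSL3 K) :
    (SemidirectProduct.inl x.left * SemidirectProduct.inr x.right : ExtendedSL3 K) = x :=
  SemidirectProduct.inl_left_mul_inr_right x

theorem extendedBorel_eq_closure :
    extendedBorel K =
      Subgroup.closure (insert (sigma K) (borelSubgroup K : Set (ExtendedSL3 K))) := by
  apply le_antisymm
  · intro x hx
    rw [← inl_left_mul_inr_right x]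
    refine mul_mem (Subgroup.subset_closure (Or.inr ⟨x.left, hx, rfl⟩)) ?_
    rcases eq_one_or_eq_graphElement x.right with h | h <;> rw [h]
    · rw [map_one]
      exact one_mem _
    · exact Subgroup.subset_closure (Or.inl rfl)
  · rw [Subgroup.closure_le]
    rintro x (rfl | hx)
    · exact one_mem (borelSL3 K)
    · exact (mem_map_inl_iff.1 hx).2

theorem borelSubgroup_le_extendedBorel : borelSubgroup K ≤ extendedBorel K :=
  fun _ hx => (mem_map_inl_iff.1 hx).2

theorem sigma_mem_extendedBorel : sigma K ∈ extendedBorel K := one_mem (borelSL3 K)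

/-- The pair `(a, b)` is an eigenvector, with eigenvalue `c`, of a unipotent Jordan block, or is
zero. -/
theorem eq_zero_of_add_eq_mul {a b c : K} (h1 : a = c * a) (h2 : b + a = c * b) : a = 0 := by
  by_contra h
  have hc : c = 1 := (mul_right_cancel₀ h (by rw [one_mul]; exact h1)).symm
  rw [hc, one_mul] at h2
  exact h (by simpa using h2)

theorem lastRow_of_conj_mem_planeStabilizer {g b : SpecialLinearGroup (Fin 3) K}
    (h : g * b * g⁻¹ ∈ planeStabilizer K) :
    ∃ c, ∀ j, (g * b) 2 j = c * g 2 j := by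
  refine ⟨(g * b * g⁻¹) 2 2, fun j => ?_⟩
  have e : g * b = (g * b * g⁻¹) * g := by group
  conv_lhs => rw [e, SL3_mul_apply, h.1, h.2]
  ring

theorem firstColumn_of_conj_mem_lineStabilizer {g b : SpecialLinearGroup (Fin 3) K}
    (h : g * b * g⁻¹ ∈ lineStabilizer K) :
    ∃ c, ∀ i, (b * g⁻¹) i 0 = c * g⁻¹ i 0 := by
  refine ⟨(g * b * g⁻¹) 0 0, fun j => ?_⟩
  have e : b * g⁻¹ = g⁻¹ * (g * b * g⁻¹) := by group
  conv_lhs => rw [e, SL3_mul_apply, h.1, h.2]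
  ring

/-- The hypothesis says that the last row of `g` is a left eigenvector of every element of `B`; the
two simple root transvections already force it to be a multiple of the last coordinate row. -/
theorem mem_planeStabilizer_of_conj {g : SpecialLinearGroup (Fin 3) K}
    (h : ∀ b ∈ borelSL3 K, g * b * g⁻¹ ∈ planeStabilizer K) : g ∈ planeStabilizer K := by
  have hdet : (1 : K) * 1 * 1 = 1 := by ring
  constructor
  · obtain ⟨c, hc⟩ := lastRow_of_conj_mem_planeStabilizer
      (h (upperSL3 1 1 1 1 0 0 hdet) (upperSL3_mem _ _ _ _ _ _ _))
    have h0 := hc 0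
    have h1 := hc 1
    rw [SL3_mul_apply, coe_upperSL3] at h0 h1
    refine eq_zero_of_add_eq_mul (c := c) (b := g 2 1) ?_ ?_
    · simpa using h0
    · simpa [add_comm] using h1
  · obtain ⟨c, hc⟩ := lastRow_of_conj_mem_planeStabilizer
      (h (upperSL3 1 1 1 0 0 1 hdet) (upperSL3_mem _ _ _ _ _ _ _))
    have h0 := hc 1
    have h1 := hc 2
    rw [SL3_mul_apply, coe_upperSL3] at h0 h1
    refine eq_zero_of_add_eq_mul (c := c) (b := g 2 2) ?_ ?_
    · simpa using h0
    · simpa [add_comm] using h1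

/-- Here the first column of `g⁻¹` is a common eigenvector of `B`, so it spans the first coordinate
line. -/
theorem mem_lineStabilizer_of_conj {g : SpecialLinearGroup (Fin 3) K}
    (h : ∀ b ∈ borelSL3 K, g * b * g⁻¹ ∈ lineStabilizer K) : g ∈ lineStabilizer K := by
  have hdet : (1 : K) * 1 * 1 = 1 := by ring
  rw [← inv_mem_iff]
  constructor
  · obtain ⟨c, hc⟩ := firstColumn_of_conj_mem_lineStabilizer
      (h (upperSL3 1 1 1 1 0 0 hdet) (upperSL3_mem _ _ _ _ _ _ _))
    have h0 := hc 1
    have h1 := hc 0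
    rw [SL3_mul_apply, coe_upperSL3] at h0 h1
    refine eq_zero_of_add_eq_mul (c := c) (b := g⁻¹ 0 0) ?_ ?_
    · simpa only [of_apply, cons_val, zero_mul, one_mul, add_zero, zero_add] using h0
    · simpa only [of_apply, cons_val, zero_mul, one_mul, add_zero, zero_add] using h1
  · obtain ⟨c, hc⟩ := firstColumn_of_conj_mem_lineStabilizer
      (h (upperSL3 1 1 1 0 0 1 hdet) (upperSL3_mem _ _ _ _ _ _ _))
    have h0 := hc 2
    have h1 := hc 1
    rw [SL3_mul_apply, coe_upperSL3] at h0 h1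
    refine eq_zero_of_add_eq_mul (c := c) (b := g⁻¹ 1 0) ?_ ?_
    · simpa only [of_apply, cons_val, zero_mul, one_mul, add_zero, zero_add] using h0
    · simpa only [of_apply, cons_val, zero_mul, one_mul, add_zero, zero_add] using h1

/-- The two standard maximal parabolic subgroups are not conjugate. -/
theorem not_forall_conj_mem_planeStabilizer (g : SpecialLinearGroup (Fin 3) K) :
    ¬ ∀ b ∈ lineStabilizer K, g * b * g⁻¹ ∈ planeStabilizer K := by
  intro h
  have hg := mem_planeStabilizer_of_conj fun b hb => h b (borelSL3_le_lineStabilizer hb)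
  obtain ⟨c, hc⟩ := lastRow_of_conj_mem_planeStabilizer
    (h (lowerSL3 0 1) (by simp [mem_lineStabilizer_iff, coe_lowerSL3]))
  have h0 := hc 2
  have h1 := hc 1
  rw [SL3_mul_apply, coe_lowerSL3] at h0 h1
  have h22 : g 2 2 = 0 := by
    refine eq_zero_of_add_eq_mul (c := c) (b := g 2 1) ?_ ?_
    · simpa using h0
    · simpa [add_comm] using h1
  exact g.row_ne_zero 2 (by
    funext j
    fin_cases j
    · exact hg.1
    · exact hg.2
    · exact h22)

/-- The graph automorphism exchanges the two parabolics and turns this into the previous statement.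
-/
theorem not_forall_conj_mem_lineStabilizer (g : SpecialLinearGroup (Fin 3) K) :
    ¬ ∀ b ∈ planeStabilizer K, g * b * g⁻¹ ∈ lineStabilizer K := by
  intro h
  apply not_forall_conj_mem_planeStabilizer (graphMap K g)
  intro b hb
  have := graphMap_mem_planeStabilizer (h _ (graphMap_mem_planeStabilizer hb))
  simpa only [← graphAutomorphism_apply, map_mul, map_inv, ← MulAut.mul_apply,
    graphAutomorphism_mul_self, MulAut.one_apply] using this

/-- The subgroups of `SL₃ ⋊ ⟨σ⟩` containing the upper triangular Borel subgroup. -/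
theorem eq_of_borelSubgroup_le {P : Subgroup (ExtendedSL3 K)} (hP : borelSubgroup K ≤ P) :
    P = borelSubgroup K ∨ P = (lineStabilizer K).map SemidirectProduct.inl ∨
      P = (planeStabilizer K).map SemidirectProduct.inl ∨ P = extendedBorel K ∨
      P = (⊤ : Subgroup (SpecialLinearGroup (Fin 3) K)).map SemidirectProduct.inl ∨ P = ⊤ := by
  set Q := P.comap SemidirectProduct.inl with hQdef
  have hQ : borelSL3 K ≤ Q := Subgroup.map_le_iff_le_comap.1 hP
  by_cases hr : ∃ x ∈ P, x.right ≠ 1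
  · obtain ⟨x, hx, hx1⟩ := hr
    have hxr : x.right = graphElement K := (eq_one_or_eq_graphElement _).resolve_left hx1
    -- Conjugation by `x = x.left σ` preserves `P` and the normal subgroup `SL₃`, hence `Q`.
    have hconj : ∀ q ∈ Q, x.left * graphMap K q * x.left⁻¹ ∈ Q := by
      intro q hq
      have := mul_mem (mul_mem hx hq) (inv_mem hx)
      rw [hQdef, Subgroup.mem_comap]
      convert this using 1
      refine SemidirectProduct.ext ?_ ?_
      · simp only [SemidirectProduct.left_inl, SemidirectProduct.mul_left,
          SemidirectProduct.inv_left, SemidirectProduct.mul_right, SemidirectProduct.right_inl,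
          mul_one, hxr, ← MulAut.mul_apply, ← map_mul, mul_inv_cancel, map_one, MulAut.one_apply]
        rfl
      · simp
    have key : ∀ S T : Subgroup (SpecialLinearGroup (Fin 3) K), Q = S →
        (∀ g ∈ T, graphMap K g ∈ S) → ∀ b ∈ T, x.left * b * x.left⁻¹ ∈ S := by
      rintro S T rfl hST b hb
      simpa only [graphMap_graphMap] using hconj _ (hST b hb)
    have hmem : ∀ y : ExtendedSL3 K, y.left * x.left⁻¹ ∈ Q → x.left ∈ Q → y ∈ P := by
      intro y hy hxQ
      -- Once `x.left` lies in `Q`, the element `σ = x.left⁻¹ x` itself lies in `P`.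
      have hs : SemidirectProduct.inr (graphElement K) ∈ P := by
        have := mul_mem (inv_mem (Subgroup.mem_comap.1 hxQ)) hx
        nth_rw 2 [← inl_left_mul_inr_right x] at this
        rwa [hxr, inv_mul_cancel_left] at this
      have hyl : y.left ∈ Q := by simpa using mul_mem hy hxQ
      rw [← inl_left_mul_inr_right y]
      refine mul_mem hyl ?_
      rcases eq_one_or_eq_graphElement y.right with h | h <;> rw [h]
      · rw [map_one]
        exact one_mem _
      · exact hs
    rcases eq_of_borelSL3_le hQ with h | h | h | h
    · have hB := key _ _ h (fun g => graphMap_mem_borelSL3)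
      have hxB : x.left ∈ borelSL3 K := mem_borelSL3_of_mem_of_mem
        (mem_lineStabilizer_of_conj fun b hb => borelSL3_le_lineStabilizer (hB b hb))
        (mem_planeStabilizer_of_conj fun b hb => borelSL3_le_planeStabilizer (hB b hb))
      refine Or.inr (Or.inr (Or.inr (Or.inl (le_antisymm ?_ ?_))))
      · intro y hy
        rcases eq_one_or_eq_graphElement y.right with hy1 | hy1
        · have : y.left ∈ Q := by
            rw [hQdef, Subgroup.mem_comap]
            have e := inl_left_mul_inr_right y
            rw [hy1, map_one, mul_one] at e
            rwa [e]
          rwa [h] at this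
        · have hyx := mul_mem hy (inv_mem hx)
          have : y.left * x.left⁻¹ ∈ Q := by
            rw [hQdef, Subgroup.mem_comap]
            convert hyx using 1
            refine SemidirectProduct.ext ?_ ?_
            · simp [hxr, hy1]
            · simp [hxr, hy1]
          rw [h] at this
          simpa [mem_extendedBorel_iff] using mul_mem this hxB
      · intro y hy
        exact hmem y (hQ (mul_mem hy (inv_mem hxB))) (hQ hxB)
    · exact absurd (key _ _ h fun g => graphMap_mem_lineStabilizer)
        (not_forall_conj_mem_lineStabilizer _)
    · exact absurd (key _ _ h fun g => graphMap_mem_planeStabilizer)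
        (not_forall_conj_mem_planeStabilizer _)
    · refine Or.inr (Or.inr (Or.inr (Or.inr (Or.inr ?_))))
      rw [eq_top_iff]
      intro y _
      exact hmem y (by simp [h]) (by simp [h])
  · push Not at hr
    have hPQ : P = Q.map SemidirectProduct.inl := by
      rw [hQdef, Subgroup.map_comap_eq_self]
      intro y hy
      exact ⟨y.left, SemidirectProduct.ext rfl (hr y hy).symm⟩
    rcases eq_of_borelSL3_le hQ with h | h | h | h <;> rw [h] at hPQ
    · exact Or.inl hPQ
    · exact Or.inr (Or.inl hPQ)
    · exact Or.inr (Or.inr (Or.inl hPQ))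
    · exact Or.inr (Or.inr (Or.inr (Or.inr (Or.inl hPQ))))

end SubgroupsOfExtendedSL3

/-! ### Regular functions on the affine line and the multiplicative group. -/

section RegularFunctions

open Polynomial

variable {k K X Y : Type*} [Field k] [Field K] [Algebra k K]

theorem regularFunctions_adjoin (S : Set (X → K)) :
    regularFunctions (Algebra.adjoin k S) = Algebra.adjoin K S :=
  Algebra.adjoin_adjoin_of_tower k S

theorem subset_regularFunctions (A : Subalgebra k (X → K)) :
    (A : Set (X → K)) ⊆ regularFunctions A :=
  Algebra.subset_adjoin

/-- To be a morphism, it suffices that generators of the coordinate ring pull back to regular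
functions. -/
theorem isMorphism_adjoin {A : Subalgebra k (X → K)} {S : Set (Y → K)} {φ : X → Y}
    (h : ∀ f ∈ S, f ∘ φ ∈ regularFunctions A) : IsMorphism A (Algebra.adjoin k S) φ := by
  intro f hf
  rw [regularFunctions_adjoin] at hf
  induction hf using Algebra.adjoin_induction with
  | mem f hf => exact h f hf
  | algebraMap c => exact (regularFunctions A).algebraMap_mem c
  | add f g _ _ hf hg => exact add_mem hf hg
  | mul f g _ _ hf hg => exact mul_mem hf hg

theorem mem_regularFunctions_affineLine {f : K → K} :
    f ∈ regularFunctions (affineLine k K) ↔ ∃ p : K[X], ∀ a, f a = p.eval a := by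
  rw [affineLine, regularFunctions_adjoin]
  constructor
  · intro hf
    induction hf using Algebra.adjoin_induction with
    | mem f hf =>
      rw [Set.mem_singleton_iff] at hf
      exact ⟨Polynomial.X, by simp [hf]⟩
    | algebraMap c => exact ⟨Polynomial.C c, by simp⟩
    | add f g _ _ hf hg =>
      obtain ⟨p, hp⟩ := hf
      obtain ⟨q, hq⟩ := hg
      exact ⟨p + q, by simp [hp, hq]⟩
    | mul f g _ _ hf hg =>
      obtain ⟨p, hp⟩ := hf
      obtain ⟨q, hq⟩ := hg
      exact ⟨p * q, by simp [hp, hq]⟩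
  · rintro ⟨p, hp⟩
    have : f = Polynomial.aeval (fun t : K => t) p := by
      funext a
      rw [hp, Polynomial.aeval_def, Polynomial.eval₂_eq_sum, Polynomial.eval_eq_sum]
      simp [Polynomial.sum_def]
    rw [this]
    exact Polynomial.aeval_mem_adjoin_singleton K _

theorem zpow_mem_regularFunctions (n : ℤ) :
    (fun t : Kˣ => ((t : K) ^ n)) ∈ regularFunctions (multiplicativeGroup k K) := by
  rw [multiplicativeGroup, regularFunctions_adjoin]
  have h1 : (fun t : Kˣ => (t : K)) ∈ Algebra.adjoin K
      {fun t : Kˣ => (t : K), fun t : Kˣ => ((t⁻¹ : Kˣ) : K)} := Algebra.subset_adjoin (by simp)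
  have h2 : (fun t : Kˣ => ((t⁻¹ : Kˣ) : K)) ∈ Algebra.adjoin K
      {fun t : Kˣ => (t : K), fun t : Kˣ => ((t⁻¹ : Kˣ) : K)} := Algebra.subset_adjoin (by simp)
  obtain ⟨m, rfl | rfl⟩ := n.eq_nat_or_neg
  · convert pow_mem h1 m using 1
    funext t
    simp
  · convert pow_mem h2 m using 1
    funext t
    simp

theorem const_mem_regularFunctions (A : Subalgebra k (X → K)) (c : K) :
    (fun _ => c) ∈ regularFunctions A :=
  (regularFunctions A).algebraMap_mem c

/-- Polynomials that agree on the multiplicative group are equal. -/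
theorem eq_of_eval_units [Infinite K] {p q : K[X]} (h : ∀ a : Kˣ, p.eval (a : K) = q.eval (a : K)) :
    p = q := by
  have : (p - q) * Polynomial.X = 0 := by
    apply Polynomial.funext
    intro a
    rcases eq_or_ne a 0 with rfl | ha
    · simp
    · have := h (Units.mk0 a ha)
      simp only [Units.val_mk0] at this
      simp [this]
  simpa [sub_eq_zero] using this

/-- A function on the multiplicative group that is polynomial both in `a` and in `a⁻¹` is
constant. -/
theorem eval_eq_eval_one_of_eval_inv [Infinite K] {p q : K[X]}
    (h : ∀ a : Kˣ, p.eval (a : K) = q.eval ((a⁻¹ : Kˣ) : K)) (a : K) : p.eval a = p.eval 1 := by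
  -- Multiplying `q(a⁻¹)` by `a ^ deg q` gives the reversed polynomial, of degree at most `deg q`;
  -- comparing degrees leaves `p` constant.
  have key : p * Polynomial.X ^ q.natDegree = q.reverse := by
    apply eq_of_eval_units
    intro a
    let _ : Invertible ((a⁻¹ : Kˣ) : K) := (a⁻¹).invertible
    have key := Polynomial.eval₂_reverse_mul_pow (RingHom.id K) ((a⁻¹ : Kˣ) : K) q
    have hinv : ⅟((a⁻¹ : Kˣ) : K) = a := by
      rw [invOf_eq_inv]
      simp
    rw [hinv, Polynomial.eval₂_id, Polynomial.eval₂_id] at key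
    rw [Polynomial.eval_mul, Polynomial.eval_pow, Polynomial.eval_X, h, ← key, mul_assoc,
      ← mul_pow, Units.inv_mul, one_pow, mul_one]
  have hdeg : p.natDegree = 0 := by
    rcases eq_or_ne p 0 with rfl | hp
    · simp
    · have h1 := Polynomial.reverse_natDegree_le q
      rw [← key, Polynomial.natDegree_mul hp (pow_ne_zero _ Polynomial.X_ne_zero),
        Polynomial.natDegree_X_pow] at h1
      omega
  rw [Polynomial.eq_C_of_natDegree_eq_zero hdeg, Polynomial.eval_C, Polynomial.eval_C]

end RegularFunctions

/-! ### A criterion for being defined over `k`. -/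

section DefinedOver

open MvPolynomial

variable {k K X ι τ : Type*} [Field k] [Field K] [Algebra k K]

/-- Since `A` is closed under multiplication, `K[X]` is its `K`-span; expanding the coefficients in
the basis `b` and collecting terms gives the sum. -/
theorem exists_sum_of_mem_regularFunctions (b : Module.Basis ι k K) {A : Subalgebra k (X → K)}
    {f : X → K} (hf : f ∈ regularFunctions A) :
    ∃ (s : Finset ι) (g : ι → X → K), (∀ j, g j ∈ A) ∧ f = ∑ j ∈ s, b j • g j := by
  classical
  have hspan : f ∈ Submodule.span K (A : Set (X → K)) := by
    have h1 : Submodule.span K (A : Set (X → K)) = Subalgebra.toSubmodule (regularFunctions A) := by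
      rw [regularFunctions, Algebra.adjoin_eq_span]
      congr 1
      exact (congrArg SetLike.coe (Submonoid.closure_eq A.toSubmonoid)).symm
    rw [h1]
    exact hf
  obtain ⟨n, c, a, rfl⟩ := Submodule.mem_span_set'.1 hspan
  refine ⟨Finset.univ.biUnion fun i => (b.repr (c i)).support,
    fun j => ∑ i, b.repr (c i) j • (a i : X → K),
    fun j => sum_mem fun i _ => A.smul_mem (a i).2 _, ?_⟩
  simp_rw [Finset.smul_sum]
  rw [Finset.sum_comm]
  refine Finset.sum_congr rfl fun i _ => ?_
  have hc : c i = ∑ j ∈ Finset.univ.biUnion fun i => (b.repr (c i)).support,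
      b.repr (c i) j • b j := by
    conv_lhs => rw [← b.linearCombination_repr (c i)]
    rw [Finsupp.linearCombination_apply, Finsupp.sum]
    apply Finset.sum_subset (Finset.subset_biUnion_of_mem (fun i => (b.repr (c i)).support)
      (Finset.mem_univ i))
    intro j _ hj
    rw [Finsupp.notMem_support_iff.1 hj, zero_smul]
  conv_lhs => rw [hc]
  rw [Finset.sum_smul]
  refine Finset.sum_congr rfl fun j _ => ?_
  rw [smul_assoc, smul_comm]

/-- A subset `Z` on which every `k`-basis of `K` remains linearly independent over the restrictions
of the `k`-regular functions. -/
def IsLinearlyDisjointOn (A : Subalgebra k (X → K)) (b : Module.Basis ι k K) (Z : Set X) : Prop :=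
  ∀ (s : Finset ι) (g : ι → X → K), (∀ j, g j ∈ A) → (∀ z ∈ Z, ∑ j ∈ s, b j * g j z = 0) →
    ∀ j ∈ s, ∀ z ∈ Z, g j z = 0

theorem IsLinearlyDisjointOn.union {A : Subalgebra k (X → K)} {b : Module.Basis ι k K}
    {Z W : Set X} (hZ : IsLinearlyDisjointOn A b Z) (hW : IsLinearlyDisjointOn A b W) :
    IsLinearlyDisjointOn A b (Z ∪ W) := by
  rintro s g hg h j hj z (hz | hz)
  · exact hZ s g hg (fun z hz => h z (Or.inl hz)) j hj z hz
  · exact hW s g hg (fun z hz => h z (Or.inr hz)) j hj z hz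

/-- Writing a function that vanishes on `Z` as `∑ b j • g j` with `g j ∈ A`, linear disjointness
makes every `g j` vanish on `Z`, which exhibits the function in the required span. -/
theorem IsLinearlyDisjointOn.isDefinedOver {A : Subalgebra k (X → K)} {b : Module.Basis ι k K}
    {Z : Set X} (h : IsLinearlyDisjointOn A b Z) (hZ : IsZariskiClosed A Z) :
    IsDefinedOver A Z := by
  refine ⟨hZ, fun f hf hfZ => ?_⟩
  obtain ⟨s, g, hg, rfl⟩ := exists_sum_of_mem_regularFunctions b hf
  refine sum_mem fun j hj => Submodule.smul_mem _ _ (Submodule.subset_span ⟨hg j, ?_⟩)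
  exact h s g hg (fun z hz => by simpa using hfZ z hz) j hj

/-- The image of a principal open subset of an affine space under a map whose coordinates are
polynomials over `k` divided by powers of the defining polynomial. -/
theorem isLinearlyDisjointOn_range [Infinite K] (b : Module.Basis ι k K) {S : Set (X → K)}
    {q : MvPolynomial τ k} (hq : q ≠ 0) (φ : {x : τ → K // aeval x q ≠ 0} → X)
    (hφ : ∀ f ∈ S, ∃ (n : ℕ) (p : MvPolynomial τ k), ∀ x, f (φ x) * aeval x.1 q ^ n = aeval x.1 p) :
    IsLinearlyDisjointOn (Algebra.adjoin k S) b (Set.range φ) := by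
  have hA : ∀ f ∈ Algebra.adjoin k S, ∃ (n : ℕ) (p : MvPolynomial τ k),
      ∀ x, f (φ x) * aeval x.1 q ^ n = aeval x.1 p := by
    intro f hf
    induction hf using Algebra.adjoin_induction with
    | mem f hf => exact hφ f hf
    | algebraMap c => exact ⟨0, C c, fun x => by simp⟩
    | add f g _ _ hf hg =>
      obtain ⟨n, p, hp⟩ := hf
      obtain ⟨m, r, hr⟩ := hg
      refine ⟨n + m, p * q ^ m + r * q ^ n, fun x => ?_⟩
      simp only [Pi.add_apply, map_add, map_mul, map_pow, ← hp, ← hr]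
      ring
    | mul f g _ _ hf hg =>
      obtain ⟨n, p, hp⟩ := hf
      obtain ⟨m, r, hr⟩ := hg
      refine ⟨n + m, p * r, fun x => ?_⟩
      simp only [Pi.mul_apply, map_mul, ← hp, ← hr]
      ring
  intro s g hg hsum
  choose n p hp using fun j => hA (g j) (hg j)
  set N := ∑ j ∈ s, n j with hN
  have hp' : ∀ j ∈ s, ∀ x, g j (φ x) * aeval x.1 q ^ N = aeval x.1 (p j * q ^ (N - n j)) := by
    intro j hj x
    have hle : n j ≤ N := Finset.single_le_sum (fun _ _ => Nat.zero_le _) hj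
    rw [map_mul, ← hp, map_pow, mul_assoc, ← pow_add, Nat.add_sub_cancel' hle]
  have hqK : MvPolynomial.map (algebraMap k K) q ≠ 0 := by
    rwa [Ne, map_eq_zero_iff _ (map_injective _ (algebraMap k K).injective)]
  have hzero : ∑ j ∈ s, C (b j) * MvPolynomial.map (algebraMap k K) (p j * q ^ (N - n j)) = 0 := by
    -- The relation is known only where `q` is nonzero. The extra factor `q` makes it hold at every
    -- point, hence as an identity of polynomials over the infinite field `K`.
    refine (mul_eq_zero.1 (?_ : _ * MvPolynomial.map (algebraMap k K) q = 0)).resolve_right hqK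
    apply MvPolynomial.funext
    intro x
    rw [map_mul, map_zero, map_sum]
    simp only [map_mul, eval_C, MvPolynomial.eval_map, ← MvPolynomial.aeval_def]
    by_cases hx : aeval x q = 0
    · rw [hx, mul_zero]
    · have h1 := hsum (φ ⟨x, hx⟩) ⟨_, rfl⟩
      have h2 : ∑ j ∈ s, b j * (aeval x (p j) * aeval x (q ^ (N - n j))) = 0 := by
        rw [← zero_mul (aeval x q ^ N), ← h1, Finset.sum_mul]
        refine Finset.sum_congr rfl fun j hj => ?_
        rw [mul_assoc, hp' j hj ⟨x, hx⟩, map_mul]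
      rw [h2, zero_mul]
  have hp0 : ∀ j ∈ s, p j * q ^ (N - n j) = 0 := by
    intro j hj
    ext m
    have h1 := congrArg (MvPolynomial.coeff m) hzero
    simp only [coeff_sum, coeff_C_mul, coeff_map, coeff_zero] at h1
    have h2 := linearIndependent_iff'.1 b.linearIndependent s
      (fun j => coeff m (p j * q ^ (N - n j))) (by
        rw [← h1]
        refine Finset.sum_congr rfl fun j _ => ?_
        rw [Algebra.smul_def, mul_comm])
    simpa using h2 j hj
  rintro j hj _ ⟨x, rfl⟩
  have := hp' j hj x
  rw [hp0 j hj, map_zero] at this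
  exact (mul_eq_zero.1 this).resolve_right (pow_ne_zero _ x.2)

theorem isDefinedOver_univ (A : Subalgebra k (X → K)) : IsDefinedOver A Set.univ := by
  refine ⟨⟨∅, by simp, by simp⟩, fun f _ h => ?_⟩
  rw [show f = 0 from funext fun x => h x trivial]
  exact zero_mem _

end DefinedOver

/-! ### Limits along cocharacters, and rigidity of cocharacters. -/

section LimitsInExtendedSL3

open Matrix Polynomial

variable {k K : Type*} [Field k] [Field K] [Algebra k K]

theorem entry_mem_coordinateRing (i j : Fin 3) :
    (fun g : ExtendedSL3 K => (g.left : Matrix (Fin 3) (Fin 3) K) i j) ∈ coordinateRing k K :=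
  Algebra.subset_adjoin (Or.inl ⟨i, j, rfl⟩)

open Classical in
theorem indicator_mem_coordinateRing (s : Subgroup.zpowers (graphAutomorphism K)) :
    (fun g : ExtendedSL3 K => if g.right = s then (1 : K) else 0) ∈ coordinateRing k K :=
  Algebra.subset_adjoin (Or.inr ⟨s, by congr⟩)

theorem exists_polynomial_of_hasLimitAtZero {φ : Kˣ → ExtendedSL3 K} {x : ExtendedSL3 K}
    (h : HasLimitAtZero (coordinateRing k K) φ x) (i j : Fin 3) :
    ∃ p : K[X], (∀ a : Kˣ, (φ a).left i j = p.eval (a : K)) ∧ x.left i j = p.eval 0 := by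
  obtain ⟨ψ, hψ, hφ, rfl⟩ := h
  obtain ⟨p, hp⟩ := mem_regularFunctions_affineLine.1
    (hψ _ (subset_regularFunctions _ (entry_mem_coordinateRing i j)))
  exact ⟨p, fun a => by rw [← hφ, ← hp]; rfl, by rw [← hp]; rfl⟩

/-- The determinant of the matrix of polynomials is `1` at every unit, so it is identically `1`, and
the extension to `0` stays in `SL₃`. -/
theorem exists_hasLimitAtZero [Infinite K] {φ : Kˣ → ExtendedSL3 K}
    {s : Subgroup.zpowers (graphAutomorphism K)} (hs : ∀ a, (φ a).right = s)
    (hp : ∀ i j, ∃ p : K[X], ∀ a : Kˣ, (φ a).left i j = p.eval (a : K)) :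
    ∃ x, HasLimitAtZero (coordinateRing k K) φ x := by
  choose p hp using hp
  have hmap : ∀ a : Kˣ, (evalRingHom (a : K)).mapMatrix (Matrix.of p) = (φ a).left := by
    intro a
    ext i j
    simp [hp]
  have hdet : (Matrix.of p).det = 1 := by
    apply eq_of_eval_units
    intro a
    rw [← coe_evalRingHom, RingHom.map_det, hmap, Matrix.SpecialLinearGroup.det_coe, _root_.map_one]
  let ψ : K → ExtendedSL3 K := fun a =>
    ⟨⟨(evalRingHom a).mapMatrix (Matrix.of p), by rw [← RingHom.map_det, hdet, map_one]⟩, s⟩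
  refine ⟨ψ 0, ψ, isMorphism_adjoin ?_, fun a => ?_, rfl⟩
  · rintro f (⟨i, j, rfl⟩ | ⟨t, rfl⟩)
    · exact mem_regularFunctions_affineLine.2 ⟨p i j, fun a => rfl⟩
    · classical
      exact const_mem_regularFunctions (affineLine k K) (if s = t then 1 else 0)
  · exact SemidirectProduct.ext (Subtype.ext (hmap a)) (hs a).symm

/-- Letting `b → 0` in `m(ab) g m(ab)⁻¹ = m(a) (m(b) g m(b)⁻¹) m(a)⁻¹` gives `g = m(a) g m(a)⁻¹`.
The limit is taken by evaluating a polynomial identity in `b` at `0`. -/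
theorem commute_of_hasLimitAtZero [Infinite K] (m : Kˣ →* Matrix.SpecialLinearGroup (Fin 3) K)
    (g : Matrix.SpecialLinearGroup (Fin 3) K)
    (h : ∀ i j, ∃ p : K[X], (∀ a : Kˣ, (m a * g * (m a)⁻¹) i j = p.eval (a : K)) ∧
      g i j = p.eval 0) (a : Kˣ) : m a * g = g * m a := by
  choose p hp h0 using h
  have key : ∀ i j, (p i j).comp (C (a : K) * X) =
      ∑ r, (∑ s, C (m a i s) * p s r) * C ((m a)⁻¹ r j) := by
    intro i j
    apply eq_of_eval_units
    intro b
    have h1 : m (a * b) * g * (m (a * b))⁻¹ = m a * (m b * g * (m b)⁻¹) * (m a)⁻¹ := by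
      rw [map_mul]
      group
    have h2 := congrArg (fun x : Matrix.SpecialLinearGroup (Fin 3) K => x i j) h1
    simp only [hp, Matrix.SpecialLinearGroup.coe_mul (m a * _) _, Matrix.SpecialLinearGroup.coe_mul (m a) _,
      mul_apply] at h2
    simpa [eval_comp, eval_finsetSum] using h2
  rw [← mul_inv_eq_iff_eq_mul]
  ext i j
  have h1 := congrArg (eval 0) (key i j)
  rw [Matrix.SpecialLinearGroup.coe_mul, Matrix.SpecialLinearGroup.coe_mul, mul_apply]
  simp only [mul_apply]
  simp only [eval_comp, eval_finsetSum, eval_mul, eval_C, eval_X, mul_zero, ← h0] at h1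
  exact h1.symm

/-- The centralizer of `B` consists of scalars, and a scalar of determinant one has cube `1`. -/
theorem pow_three_eq_one_of_commute [Infinite K] {g : Matrix.SpecialLinearGroup (Fin 3) K}
    (h : ∀ b ∈ borelSL3 K, g * b = b * g) : g ^ 3 = 1 := by
  have hdet : (1 : K) * 1 * 1 = 1 := by ring
  classical
  -- The two transvections leave `g 0 2` free; `diag(u, u⁻¹, 1)` with `u ≠ 1` removes it.
  obtain ⟨u, hu⟩ := Infinite.exists_notMem_finset (insert 0 {1} : Finset K)
  simp only [Finset.mem_insert, Finset.mem_singleton, not_or] at hu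
  have hdet' : u * u⁻¹ * 1 = 1 := by rw [mul_inv_cancel₀ hu.1, mul_one]
  have h1 : ∀ i j, (g * upperSL3 1 1 1 1 0 0 hdet) i j = (upperSL3 1 1 1 1 0 0 hdet * g) i j :=
    fun i j => by rw [h _ (upperSL3_mem _ _ _ _ _ _ _)]
  have h2 : ∀ i j, (g * upperSL3 1 1 1 0 0 1 hdet) i j = (upperSL3 1 1 1 0 0 1 hdet * g) i j :=
    fun i j => by rw [h _ (upperSL3_mem _ _ _ _ _ _ _)]
  have h3 : ∀ i j, (g * upperSL3 u u⁻¹ 1 0 0 0 hdet') i j = (upperSL3 u u⁻¹ 1 0 0 0 hdet' * g) i j :=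
    fun i j => by rw [h _ (upperSL3_mem _ _ _ _ _ _ _)]
  simp only [SL3_mul_apply, coe_upperSL3] at h1 h2 h3
  have e10 : g 1 0 = 0 := by simpa using (h1 0 0).symm
  have e20 : g 2 0 = 0 := by simpa using h1 2 1
  have e12 : g 1 2 = 0 := by simpa using (h1 0 2).symm
  have e21 : g 2 1 = 0 := by simpa using h2 2 2
  have e01 : g 0 1 = 0 := by simpa using h2 0 2
  have e02 : g 0 2 = 0 := by
    have := h3 0 2
    simp at this
    have h' : (u - 1) * g 0 2 = 0 := by linear_combination -this
    exact (mul_eq_zero.1 h').resolve_left (sub_ne_zero.2 hu.2)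
  have e11 : g 1 1 = g 0 0 := by simpa [e01, add_comm, eq_comm] using h1 0 1
  have e22 : g 2 2 = g 1 1 := by simpa [e12, add_comm, eq_comm] using h2 1 2
  have hd := g.det_coe
  rw [det_fin_three, e10, e20, e12, e21, e01, e02, e22, e11] at hd
  ext i j
  rw [pow_succ, pow_two, SL3_mul_apply, SL3_mul_apply, SL3_mul_apply, SL3_mul_apply]
  fin_cases i <;> fin_cases j <;> simp [e10, e20, e12, e21, e01, e02, e22, e11] <;>
    linear_combination hd

/-- If all conjugates `m(a) g m(a)⁻¹` are polynomial in `a`, then `m` is central. -/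
theorem commute_of_forall_polynomial [Infinite K] (m : Kˣ →* Matrix.SpecialLinearGroup (Fin 3) K)
    (h : ∀ (g : Matrix.SpecialLinearGroup (Fin 3) K) (i j : Fin 3), ∃ p : K[X],
      ∀ a : Kˣ, (m a * g * (m a)⁻¹) i j = p.eval (a : K))
    (a : Kˣ) (g : Matrix.SpecialLinearGroup (Fin 3) K) : m a * g = g * m a := by
  let Pol : Matrix (Fin 3) (Fin 3) K → Prop := fun x => ∀ i j, ∃ p : K[X],
    ∀ a : Kˣ, ((m a : Matrix (Fin 3) (Fin 3) K) * x * ((m a)⁻¹ : Matrix.SpecialLinearGroup (Fin 3) K))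
      i j = p.eval (a : K)
  have hPol : ∀ g : Matrix.SpecialLinearGroup (Fin 3) K, Pol g := fun g i j => by
    obtain ⟨p, hp⟩ := h g i j
    exact ⟨p, fun a => by rw [← hp, Matrix.SpecialLinearGroup.coe_mul, Matrix.SpecialLinearGroup.coe_mul]⟩
  have hsub : ∀ x y, Pol x → Pol y → Pol (x - y) := fun x y hx hy i j => by
    obtain ⟨p, hp⟩ := hx i j
    obtain ⟨q, hq⟩ := hy i j
    exact ⟨p - q, fun a => by rw [mul_sub, sub_mul, Matrix.sub_apply, hp, hq, eval_sub]⟩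
  have hmul : ∀ x y, Pol x → Pol y → Pol (x * y) := fun x y hx hy i j => by
    choose p hp using hx
    choose q hq using hy
    refine ⟨∑ r, p i r * q r j, fun a => ?_⟩
    have e : (((m a)⁻¹ : Matrix.SpecialLinearGroup (Fin 3) K) : Matrix (Fin 3) (Fin 3) K) * m a = 1 := by
      rw [← Matrix.SpecialLinearGroup.coe_mul, inv_mul_cancel, Matrix.SpecialLinearGroup.coe_one]
    have e' : (m a : Matrix (Fin 3) (Fin 3) K) * (x * y) *
        ((m a)⁻¹ : Matrix.SpecialLinearGroup (Fin 3) K) =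
        ((m a : Matrix (Fin 3) (Fin 3) K) * x * ((m a)⁻¹ : Matrix.SpecialLinearGroup (Fin 3) K)) *
        ((m a : Matrix (Fin 3) (Fin 3) K) * y * ((m a)⁻¹ : Matrix.SpecialLinearGroup (Fin 3) K)) := by
      calc _ = (m a : Matrix (Fin 3) (Fin 3) K) * x * 1 * y *
            ((m a)⁻¹ : Matrix.SpecialLinearGroup (Fin 3) K) := by simp only [mul_assoc, one_mul]
        _ = _ := by
          rw [← e]
          simp only [mul_assoc]
    rw [e', mul_apply]
    simp only [eval_finsetSum, eval_mul, hp, hq]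
  -- An off-diagonal matrix unit is a transvection minus the identity; products of these give the
  -- diagonal ones.
  have hoff : ∀ i j, i ≠ j → Pol (single i j 1) := fun i j hij => by
    have := hsub _ _ (hPol (Matrix.SpecialLinearGroup.transvection hij 1)) (hPol 1)
    rwa [Matrix.SpecialLinearGroup.transvection_coe, Matrix.SpecialLinearGroup.coe_one, add_sub_cancel_left]
      at this
  have hsingle : ∀ i j, Pol (single i j 1) := fun i j => by
    rcases eq_or_ne i j with rfl | hij
    · obtain ⟨r, hr⟩ := exists_ne i
      have := hmul _ _ (hoff i r hr.symm) (hoff r i hr)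
      rwa [single_mul_single_same, mul_one] at this
    · exact hoff i j hij
  have hent : ∀ i j r l, ∃ p : K[X], ∀ a : Kˣ, m a i j * (m a)⁻¹ r l = p.eval (a : K) := by
    intro i j r l
    obtain ⟨p, hp⟩ := hsingle j r i l
    refine ⟨p, fun a => ?_⟩
    rw [← hp]
    rw [mul_apply, Finset.sum_eq_single r]
    · rw [mul_single_apply_same, mul_one]
    · intro s _ hs
      rw [mul_single_apply_of_ne _ _ _ _ _ hs, zero_mul]
    · simp
  -- Exchanging the two factors amounts to replacing `a` by `a⁻¹`, so each product is polynomial in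
  -- both `a` and `a⁻¹`, hence equal to its value at `a = 1`.
  have hone : ∀ i j r l, m a i j * (m a)⁻¹ r l =
      (1 : Matrix (Fin 3) (Fin 3) K) i j * (1 : Matrix (Fin 3) (Fin 3) K) r l := by
    intro i j r l
    obtain ⟨p, hp⟩ := hent i j r l
    obtain ⟨q, hq⟩ := hent r l i j
    have hpq : ∀ a : Kˣ, p.eval (a : K) = q.eval ((a⁻¹ : Kˣ) : K) := by
      intro a
      rw [← hp, ← hq, map_inv, inv_inv, mul_comm]
    rw [hp, eval_eq_eval_one_of_eval_inv hpq, ← Units.val_one, ← hp, map_one, inv_one,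
      Matrix.SpecialLinearGroup.coe_one]
  rw [← mul_inv_eq_iff_eq_mul]
  ext i j
  rw [Matrix.SpecialLinearGroup.coe_mul, Matrix.SpecialLinearGroup.coe_mul, mul_apply]
  simp only [mul_apply, Finset.sum_mul]
  calc _ = ∑ r, ∑ s, (1 : Matrix (Fin 3) (Fin 3) K) i s * g s r *
        (1 : Matrix (Fin 3) (Fin 3) K) r j := by
        refine Finset.sum_congr rfl fun r _ => Finset.sum_congr rfl fun s _ => ?_
        rw [mul_right_comm, hone, mul_right_comm]
    _ = g i j := by simp [one_apply]

/-- Every element of `Kˣ` is a square, while `⟨σ⟩` has exponent two. -/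
theorem cocharacter_right [IsAlgClosed K] (l : Kˣ →* ExtendedSL3 K) (a : Kˣ) :
    (l a).right = 1 := by
  obtain ⟨z, hz⟩ := IsAlgClosed.exists_pow_nat_eq (a : K) (n := 2) (by norm_num)
  have hz0 : z ≠ 0 := by
    rintro rfl
    exact a.ne_zero (by simpa using hz.symm)
  have ha : a = Units.mk0 z hz0 * Units.mk0 z hz0 := by
    ext
    simp [← hz, pow_two]
  rw [ha, map_mul, SemidirectProduct.mul_right, mul_self_eq_one]

/-- Every cocharacter of `SL₃ ⋊ ⟨σ⟩` takes its values in `SL₃`. -/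
theorem exists_eq_inl_comp [IsAlgClosed K] (l : Kˣ →* ExtendedSL3 K) :
    ∃ m : Kˣ →* Matrix.SpecialLinearGroup (Fin 3) K, l = SemidirectProduct.inl.comp m := by
  refine ⟨{ toFun := fun a => (l a).left, map_one' := by simp, map_mul' := fun a b => ?_ }, ?_⟩
  · simp [cocharacter_right]
  · ext1 a
    exact SemidirectProduct.ext rfl (cocharacter_right l a)

/-- The values have cube `1`, and every element of `Kˣ` is a cube. -/
theorem eq_one_of_commute [IsAlgClosed K] (m : Kˣ →* Matrix.SpecialLinearGroup (Fin 3) K)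
    (h : ∀ a, ∀ b ∈ borelSL3 K, m a * b = b * m a) : m = 1 := by
  ext1 a
  obtain ⟨z, hz⟩ := IsAlgClosed.exists_pow_nat_eq (a : K) (n := 3) (by norm_num)
  have hz0 : z ≠ 0 := by
    rintro rfl
    exact a.ne_zero (by simpa using hz.symm)
  have ha : a = Units.mk0 z hz0 ^ 3 := by
    ext
    simp [← hz]
  rw [ha, map_pow, pow_three_eq_one_of_commute (h _), MonoidHom.one_apply]

theorem parabolicSet_one : parabolicSet (coordinateRing k K) 1 = Set.univ := by
  rw [Set.eq_univ_iff_forall]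
  intro g
  refine ⟨g, fun _ => g, isMorphism_adjoin ?_, fun a => by simp, rfl⟩
  intro f _
  exact const_mem_regularFunctions _ _

theorem inl_conj (m g : Matrix.SpecialLinearGroup (Fin 3) K) :
    (SemidirectProduct.inl m * SemidirectProduct.inl g * (SemidirectProduct.inl m)⁻¹ :
      ExtendedSL3 K) = SemidirectProduct.inl (m * g * m⁻¹) := by
  simp

/-- The subgroup `SL₃` of `SL₃ ⋊ ⟨σ⟩` is not an R-parabolic subgroup. -/
theorem not_isRParabolic_SL3 [IsAlgClosed K] :
    ¬ IsRParabolic (coordinateRing k K)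
      ((⊤ : Subgroup (Matrix.SpecialLinearGroup (Fin 3) K)).map SemidirectProduct.inl) := by
  rintro ⟨l, -, hl⟩
  obtain ⟨m, rfl⟩ := exists_eq_inl_comp l
  have hm : m = 1 := by
    refine eq_one_of_commute m fun a b _ => commute_of_forall_polynomial m (fun g i j => ?_) a b
    have hg : (SemidirectProduct.inl g : ExtendedSL3 K) ∈
        parabolicSet (coordinateRing k K) (SemidirectProduct.inl.comp m) := by
      rw [← hl]
      exact ⟨g, trivial, rfl⟩
    obtain ⟨x, hx⟩ := hg
    obtain ⟨p, hp, -⟩ := exists_polynomial_of_hasLimitAtZero hx i j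
    refine ⟨p, fun a => ?_⟩
    rw [← hp, MonoidHom.comp_apply, inl_conj, SemidirectProduct.left_inl]
  rw [hm, MonoidHom.comp_one, parabolicSet_one] at hl
  have hs : sigma K ∈ (⊤ : Subgroup (Matrix.SpecialLinearGroup (Fin 3) K)).map
      (SemidirectProduct.inl : _ →* ExtendedSL3 K) := by
    rw [← SetLike.mem_coe, hl]
    trivial
  exact graphElement_ne_one (mem_map_inl_iff.1 hs).1

/-- An R-Levi subgroup containing the Borel subgroup is an R-Levi subgroup of the whole group. -/
theorem eq_top_of_borelSubgroup_le_isRLevi [IsAlgClosed K] {P L : Subgroup (ExtendedSL3 K)}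
    (h : IsRLevi (coordinateRing k K) P L) (hL : borelSubgroup K ≤ L) : P = ⊤ := by
  obtain ⟨l, -, hP, hL'⟩ := h
  obtain ⟨m, rfl⟩ := exists_eq_inl_comp l
  have hm : m = 1 := by
    refine eq_one_of_commute m fun a b hb => commute_of_hasLimitAtZero m b (fun i j => ?_) a
    have hg : (SemidirectProduct.inl b : ExtendedSL3 K) ∈
        leviSet (coordinateRing k K) (SemidirectProduct.inl.comp m) := by
      rw [← hL']
      exact hL ⟨b, hb, rfl⟩
    obtain ⟨p, hp, h0⟩ := exists_polynomial_of_hasLimitAtZero hg i j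
    refine ⟨p, fun a => ?_, ?_⟩
    · rw [← hp, MonoidHom.comp_apply, inl_conj, SemidirectProduct.left_inl]
    · rw [← h0, SemidirectProduct.left_inl]
  rw [hm, MonoidHom.comp_one, parabolicSet_one] at hP
  exact SetLike.coe_injective hP

end LimitsInExtendedSL3

/-! ### Explicit cocharacters and their R-parabolic subgroups. -/

section DiagonalCocharacters

open Matrix

variable {k K : Type*} [Field k] [Field K] [Algebra k K]

variable (K) in
/-- The diagonal cocharacter `a ↦ diag(a ^ n₀, a ^ n₁, a ^ n₂)` of `SL₃`. -/
def diagonalCocharacter (n : Fin 3 → ℤ) (hn : n 0 + n 1 + n 2 = 0) :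
    Kˣ →* Matrix.SpecialLinearGroup (Fin 3) K where
  toFun a := ⟨diagonal fun i => (a : K) ^ n i, by
    rw [det_diagonal, Fin.prod_univ_three, ← zpow_add₀ a.ne_zero, ← zpow_add₀ a.ne_zero, hn,
      zpow_zero]⟩
  map_one' := by
    ext i j
    simp [one_apply, diagonal_apply]
  map_mul' a b := by
    refine Subtype.ext (Eq.trans ?_ (diagonal_mul_diagonal _ _).symm)
    simp [mul_zpow]

theorem coe_diagonalCocharacter (n : Fin 3 → ℤ) (hn : n 0 + n 1 + n 2 = 0) (a : Kˣ) :
    (diagonalCocharacter K n hn a : Matrix (Fin 3) (Fin 3) K) = diagonal fun i => (a : K) ^ n i :=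
  rfl

theorem diagonalCocharacter_inv (n : Fin 3 → ℤ) (hn : n 0 + n 1 + n 2 = 0) (a : Kˣ) :
    ((diagonalCocharacter K n hn a)⁻¹ : Matrix.SpecialLinearGroup (Fin 3) K) =
      (diagonal fun i => (a : K) ^ (-n i) : Matrix (Fin 3) (Fin 3) K) := by
  rw [← map_inv, coe_diagonalCocharacter]
  simp

theorem graphMap_diagonalCocharacter (n n' : Fin 3 → ℤ) (hn : n 0 + n 1 + n 2 = 0)
    (hn' : n' 0 + n' 1 + n' 2 = 0) (h0 : n' 0 = -n 2) (h1 : n' 1 = -n 1) (a : Kˣ) :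
    graphMap K (diagonalCocharacter K n hn a) = diagonalCocharacter K n' hn' a := by
  have e0 : n 0 + n 1 = n' 0 := by omega
  have e1 : n 0 + n 2 = n' 1 := by omega
  have e2 : n 1 + n 2 = n' 2 := by omega
  ext i j
  rw [coe_graphMap, coe_diagonalCocharacter, coe_diagonalCocharacter]
  fin_cases i <;> fin_cases j <;>
    simp [← zpow_add₀ a.ne_zero, e0, e1, e2]

theorem isCocharacter_diagonalCocharacter (n : Fin 3 → ℤ) (hn : n 0 + n 1 + n 2 = 0) :
    IsCocharacter (coordinateRing k K)
      (SemidirectProduct.inl.comp (diagonalCocharacter K n hn)) := by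
  apply isMorphism_adjoin
  rintro f (⟨i, j, rfl⟩ | ⟨t, rfl⟩)
  · rcases eq_or_ne i j with rfl | hij
    · convert zpow_mem_regularFunctions (n i) using 1
      funext a
      simp [coe_diagonalCocharacter]
    · convert const_mem_regularFunctions (multiplicativeGroup k K) 0 using 1
      funext a
      simp [coe_diagonalCocharacter, hij]
  · classical
    exact const_mem_regularFunctions (multiplicativeGroup k K)
      (if (1 : Subgroup.zpowers (graphAutomorphism K)) = t then 1 else 0)

/-- Conjugation multiplies the entry `(i, j)` by `a ^ (n i - n' j)`, where `n'` records the weights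
after twisting by the component of `g`. The limit exists exactly when no nonzero entry meets a
negative exponent. -/
theorem mem_parabolicSet_diagonalCocharacter_iff [Infinite K] {n n' : Fin 3 → ℤ}
    (hn : n 0 + n 1 + n 2 = 0) (hn' : n' 0 + n' 1 + n' 2 = 0) {g : ExtendedSL3 K}
    (h : ∀ a, g.right.1 (diagonalCocharacter K n hn a) = diagonalCocharacter K n' hn' a) :
    g ∈ parabolicSet (coordinateRing k K)
        (SemidirectProduct.inl.comp (diagonalCocharacter K n hn)) ↔
      ∀ i j, n i < n' j → g.left i j = 0 := by
  set l := (SemidirectProduct.inl : _ →* ExtendedSL3 K).comp (diagonalCocharacter K n hn) with hl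
  have hright : ∀ a, (l a * g * (l a)⁻¹).right = g.right := fun a => by simp [hl]
  have hleft : ∀ a i j, (l a * g * (l a)⁻¹).left i j = (a : K) ^ (n i - n' j) * g.left i j := by
    intro a i j
    have e : (l a * g * (l a)⁻¹).left =
        diagonalCocharacter K n hn a * g.left * (diagonalCocharacter K n' hn' a)⁻¹ := by
      rw [← h, ← map_inv]
      simp [hl]
    rw [e, Matrix.SpecialLinearGroup.coe_mul, Matrix.SpecialLinearGroup.coe_mul,
      diagonalCocharacter_inv, coe_diagonalCocharacter, mul_diagonal, diagonal_mul,
      sub_eq_add_neg, zpow_add₀ a.ne_zero]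
    ring
  constructor
  · rintro ⟨x, hx⟩ i j hij
    obtain ⟨p, hp, -⟩ := exists_polynomial_of_hasLimitAtZero hx i j
    obtain ⟨d, hd⟩ := Int.eq_ofNat_of_zero_le (sub_nonneg.2 hij.le)
    have hd0 : d ≠ 0 := by
      rintro rfl
      omega
    have key : p * Polynomial.X ^ d = Polynomial.C (g.left i j) := by
      apply eq_of_eval_units
      intro a
      rw [Polynomial.eval_mul, ← hp, hleft, Polynomial.eval_pow, Polynomial.eval_X,
        Polynomial.eval_C, mul_right_comm, ← zpow_natCast, ← zpow_add₀ a.ne_zero]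
      have : n i - n' j + (d : ℤ) = 0 := by omega
      rw [this, zpow_zero, one_mul]
    have := congrArg (Polynomial.eval 0) key
    simpa [hd0] using this.symm
  · intro hg
    refine exists_hasLimitAtZero hright fun i j => ?_
    rcases lt_or_ge (n i) (n' j) with hij | hij
    · exact ⟨0, fun a => by rw [hleft, hg i j hij]; simp⟩
    · obtain ⟨d, hd⟩ := Int.eq_ofNat_of_zero_le (sub_nonneg.2 hij)
      refine ⟨Polynomial.C (g.left i j) * Polynomial.X ^ d, fun a => ?_⟩
      rw [hleft, hd, zpow_natCast, mul_comm, Polynomial.eval_mul, Polynomial.eval_C,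
        Polynomial.eval_pow, Polynomial.eval_X]

theorem parabolicSet_diagonalCocharacter [Infinite K] {n n' : Fin 3 → ℤ}
    (hn : n 0 + n 1 + n 2 = 0) (hn' : n' 0 + n' 1 + n' 2 = 0) (h0 : n' 0 = -n 2)
    (h1 : n' 1 = -n 1) {g : ExtendedSL3 K} :
    g ∈ parabolicSet (coordinateRing k K)
        (SemidirectProduct.inl.comp (diagonalCocharacter K n hn)) ↔
      (g.right = 1 ∧ ∀ i j, n i < n j → g.left i j = 0) ∨
        (g.right = graphElement K ∧ ∀ i j, n i < n' j → g.left i j = 0) := by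
  rcases eq_one_or_eq_graphElement g.right with h | h
  · rw [mem_parabolicSet_diagonalCocharacter_iff hn hn (fun a => by rw [h]; rfl)]
    simp [h, graphElement_ne_one.symm]
  · rw [mem_parabolicSet_diagonalCocharacter_iff hn hn'
      (fun a => by rw [h]; exact graphMap_diagonalCocharacter n n' hn hn' h0 h1 a)]
    simp [h, graphElement_ne_one]

/-- The weights `(1, 0, -1)` are strictly decreasing, which gives `B`, and are fixed by `σ`, so both
cosets obey the same condition. -/
theorem isRParabolic_extendedBorel [Infinite K] :
    IsRParabolic (coordinateRing k K) (extendedBorel K) := by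
  have hn : (![1, 0, -1] : Fin 3 → ℤ) 0 + (![1, 0, -1] : Fin 3 → ℤ) 1 +
    (![1, 0, -1] : Fin 3 → ℤ) 2 = 0 := by simp
  refine ⟨_, isCocharacter_diagonalCocharacter ![1, 0, -1] hn, Set.ext fun g => ?_⟩
  rw [parabolicSet_diagonalCocharacter hn hn (by simp) (by simp), SetLike.mem_coe,
    mem_extendedBorel_iff, mem_borelSL3_iff, ← or_and_right]
  simp [eq_one_or_eq_graphElement, Fin.forall_fin_succ]

/-- The weights `(3, -1, -2)` are also strictly decreasing, but `σ` sends them to `(2, 1, -3)`. On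
the outer coset the last two rows would then vanish in the first two columns, contradicting
determinant one. -/
theorem isRParabolic_borelSubgroup [Infinite K] :
    IsRParabolic (coordinateRing k K) (borelSubgroup K) := by
  have hn : (![3, -1, -2] : Fin 3 → ℤ) 0 + (![3, -1, -2] : Fin 3 → ℤ) 1 +
    (![3, -1, -2] : Fin 3 → ℤ) 2 = 0 := by simp
  have hn' : (![2, 1, -3] : Fin 3 → ℤ) 0 + (![2, 1, -3] : Fin 3 → ℤ) 1 +
    (![2, 1, -3] : Fin 3 → ℤ) 2 = 0 := by simp
  refine ⟨_, isCocharacter_diagonalCocharacter ![3, -1, -2] hn, Set.ext fun g => ?_⟩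
  rw [parabolicSet_diagonalCocharacter hn hn' (by simp) (by simp), SetLike.mem_coe,
    borelSubgroup, mem_map_inl_iff, mem_borelSL3_iff, or_iff_left]
  · simp [Fin.forall_fin_succ]
  · rintro ⟨-, h⟩
    have hd := g.left.det_coe
    rw [det_fin_three, h 1 0 (by simp), h 1 1 (by simp), h 2 0 (by simp), h 2 1 (by simp)] at hd
    simp at hd

theorem isRParabolic_planeStabilizer [Infinite K] :
    IsRParabolic (coordinateRing k K) ((planeStabilizer K).map SemidirectProduct.inl) := by
  have hn : (![1, 1, -2] : Fin 3 → ℤ) 0 + (![1, 1, -2] : Fin 3 → ℤ) 1 +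
    (![1, 1, -2] : Fin 3 → ℤ) 2 = 0 := by simp
  have hn' : (![2, -1, -1] : Fin 3 → ℤ) 0 + (![2, -1, -1] : Fin 3 → ℤ) 1 +
    (![2, -1, -1] : Fin 3 → ℤ) 2 = 0 := by simp
  refine ⟨_, isCocharacter_diagonalCocharacter ![1, 1, -2] hn, Set.ext fun g => ?_⟩
  rw [parabolicSet_diagonalCocharacter hn hn' (by simp) (by simp), SetLike.mem_coe,
    mem_map_inl_iff, mem_planeStabilizer_iff, or_iff_left]
  · simp [Fin.forall_fin_succ]
  · rintro ⟨-, h⟩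
    have hd := g.left.det_coe
    rw [det_fin_three, h 2 0 (by simp), h 2 1 (by simp), h 2 2 (by simp)] at hd
    simp at hd

theorem isRParabolic_lineStabilizer [Infinite K] :
    IsRParabolic (coordinateRing k K) ((lineStabilizer K).map SemidirectProduct.inl) := by
  have hn : (![2, -1, -1] : Fin 3 → ℤ) 0 + (![2, -1, -1] : Fin 3 → ℤ) 1 +
    (![2, -1, -1] : Fin 3 → ℤ) 2 = 0 := by simp
  have hn' : (![1, 1, -2] : Fin 3 → ℤ) 0 + (![1, 1, -2] : Fin 3 → ℤ) 1 +
    (![1, 1, -2] : Fin 3 → ℤ) 2 = 0 := by simp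
  refine ⟨_, isCocharacter_diagonalCocharacter ![2, -1, -1] hn, Set.ext fun g => ?_⟩
  rw [parabolicSet_diagonalCocharacter hn hn' (by simp) (by simp), SetLike.mem_coe,
    mem_map_inl_iff, mem_lineStabilizer_iff, or_iff_left]
  · simp [Fin.forall_fin_succ]
  · rintro ⟨-, h⟩
    have hd := g.left.det_coe
    rw [det_fin_three, h 1 0 (by simp), h 1 1 (by simp), h 2 0 (by simp), h 2 1 (by simp)] at hd
    simp at hd

theorem isRParabolic_top : IsRParabolic (coordinateRing k K) ⊤ :=
  ⟨1, isMorphism_adjoin fun f _ => const_mem_regularFunctions _ (f 1),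
    by rw [parabolicSet_one, Subgroup.coe_top]⟩

end DiagonalCocharacters

/-! ### The overgroups of the Borel subgroup are defined over `k`. -/

section DefinedOverBaseField

open Matrix MvPolynomial

variable {k K ι τ : Type*} [Field k] [Field K] [Algebra k K]

/-- A subset of a component of `SL₃ ⋊ ⟨σ⟩` parametrized by matrices whose entries are polynomials
over `k` divided by powers of `q`. -/
theorem isLinearlyDisjointOn_of_parametrization [Infinite K] (b : Module.Basis ι k K)
    {q : MvPolynomial τ k} (hq : q ≠ 0)
    (s : Subgroup.zpowers (graphAutomorphism K)) {Q : Set (Matrix.SpecialLinearGroup (Fin 3) K)}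
    (M : {x : τ → K // aeval x q ≠ 0} → Matrix.SpecialLinearGroup (Fin 3) K)
    (hM : Set.range M = Q)
    (n : Matrix (Fin 3) (Fin 3) ℕ) (p : Matrix (Fin 3) (Fin 3) (MvPolynomial τ k))
    (h : ∀ x i j, M x i j * aeval x.1 q ^ n i j = aeval x.1 (p i j)) :
    IsLinearlyDisjointOn (coordinateRing k K) b {g | g.right = s ∧ g.left ∈ Q} := by
  have hZ : {g : ExtendedSL3 K | g.right = s ∧ g.left ∈ Q} =
      Set.range fun x => (⟨M x, s⟩ : ExtendedSL3 K) := by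
    ext g
    subst hM
    constructor
    · rintro ⟨h1, x, hx⟩
      exact ⟨x, SemidirectProduct.ext hx h1.symm⟩
    · rintro ⟨x, rfl⟩
      exact ⟨rfl, x, rfl⟩
  rw [hZ]
  apply isLinearlyDisjointOn_range b hq
  rintro f (⟨i, j, rfl⟩ | ⟨t, rfl⟩)
  · exact ⟨n i j, p i j, fun x => h x i j⟩
  · by_cases hst : s = t
    · exact ⟨0, 1, fun x => by simp [hst]⟩
    · exact ⟨0, 0, fun x => by simp [hst]⟩

theorem isLinearlyDisjointOn_borelSL3 [Infinite K] (b : Module.Basis ι k K)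
    (s : Subgroup.zpowers (graphAutomorphism K)) :
    IsLinearlyDisjointOn (coordinateRing k K) b {g | g.right = s ∧ g.left ∈ borelSL3 K} := by
  -- The free coordinates are the first two diagonal entries and the three entries above the
  -- diagonal; the last diagonal entry is `q⁻¹`.
  let q : MvPolynomial (Fin 5) k := X 0 * X 1
  have hq : ∀ x : Fin 5 → K, aeval x q = x 0 * x 1 := fun x => by simp [q]
  let M : {x : Fin 5 → K // aeval x q ≠ 0} → Matrix.SpecialLinearGroup (Fin 3) K := fun x =>
    ⟨!![x.1 0, x.1 2, x.1 3; 0, x.1 1, x.1 4; 0, 0, (aeval x.1 q)⁻¹], by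
      have := mul_inv_cancel₀ x.2
      simp only [det_fin_three, of_apply, cons_val]
      linear_combination this + (aeval x.1 q)⁻¹ * -hq x.1⟩
  refine isLinearlyDisjointOn_of_parametrization b (mul_ne_zero (X_ne_zero 0) (X_ne_zero 1)) s M ?_
    !![0, 0, 0; 0, 0, 0; 0, 0, 1] !![X 0, X 2, X 3; 0, X 1, X 4; 0, 0, 1] ?_
  · ext g
    rw [SetLike.mem_coe, mem_borelSL3_iff]
    constructor
    · rintro ⟨x, rfl⟩
      simp [M]
    · rintro ⟨h1, h2, h3⟩
      have hd := g.det_coe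
      rw [det_fin_three, h1, h2, h3] at hd
      replace hd : (g 0 0 * g 1 1) * g 2 2 = 1 := by linear_combination hd
      have hx : aeval ![g 0 0, g 1 1, g 0 1, g 0 2, g 1 2] q = g 0 0 * g 1 1 := by simp [hq]
      refine ⟨⟨![g 0 0, g 1 1, g 0 1, g 0 2, g 1 2], ?_⟩, ?_⟩
      · rw [hx]
        exact left_ne_zero_of_mul_eq_one hd
      · ext i j
        simp only [M, hx, inv_eq_of_mul_eq_one_right hd]
        fin_cases i <;> fin_cases j <;> simp [h1, h2, h3]
  · intro x i j
    fin_cases i <;> fin_cases j <;> simp [M]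
    rw [← hq x.1]
    exact inv_mul_cancel₀ x.2

theorem isLinearlyDisjointOn_planeStabilizer [Infinite K] (b : Module.Basis ι k K)
    (s : Subgroup.zpowers (graphAutomorphism K)) :
    IsLinearlyDisjointOn (coordinateRing k K) b
      {g | g.right = s ∧ g.left ∈ planeStabilizer K} := by
  let q : MvPolynomial (Fin 6) k := X 0 * X 3 - X 1 * X 2
  have hq : ∀ x : Fin 6 → K, aeval x q = x 0 * x 3 - x 1 * x 2 := fun x => by simp [q]
  have hq0 : q ≠ 0 := fun h => by
    have := congrArg (eval (![1, 0, 0, 1, 0, 0] : Fin 6 → k)) h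
    simp [q] at this
  let M : {x : Fin 6 → K // aeval x q ≠ 0} → Matrix.SpecialLinearGroup (Fin 3) K := fun x =>
    ⟨!![x.1 0, x.1 1, x.1 4; x.1 2, x.1 3, x.1 5; 0, 0, (aeval x.1 q)⁻¹], by
      have := mul_inv_cancel₀ x.2
      simp only [det_fin_three, of_apply, cons_val]
      linear_combination this + (aeval x.1 q)⁻¹ * -hq x.1⟩
  refine isLinearlyDisjointOn_of_parametrization b hq0 s M ?_
    !![0, 0, 0; 0, 0, 0; 0, 0, 1] !![X 0, X 1, X 4; X 2, X 3, X 5; 0, 0, 1] ?_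
  · ext g
    rw [SetLike.mem_coe, mem_planeStabilizer_iff]
    constructor
    · rintro ⟨x, rfl⟩
      simp [M]
    · rintro ⟨h1, h2⟩
      have hd := g.det_coe
      rw [det_fin_three, h1, h2] at hd
      replace hd : (g 0 0 * g 1 1 - g 0 1 * g 1 0) * g 2 2 = 1 := by
        linear_combination hd
      have hx : aeval ![g 0 0, g 0 1, g 1 0, g 1 1, g 0 2, g 1 2] q =
        g 0 0 * g 1 1 - g 0 1 * g 1 0 := by simp [hq]
      refine ⟨⟨![g 0 0, g 0 1, g 1 0, g 1 1, g 0 2, g 1 2], ?_⟩, ?_⟩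
      · rw [hx]
        exact left_ne_zero_of_mul_eq_one hd
      · ext i j
        simp only [M, hx, inv_eq_of_mul_eq_one_right hd]
        fin_cases i <;> fin_cases j <;> simp [h1, h2]
  · intro x i j
    have := x.2
    fin_cases i <;> fin_cases j <;> simp [M, this]

theorem isLinearlyDisjointOn_lineStabilizer [Infinite K] (b : Module.Basis ι k K)
    (s : Subgroup.zpowers (graphAutomorphism K)) :
    IsLinearlyDisjointOn (coordinateRing k K) b
      {g | g.right = s ∧ g.left ∈ lineStabilizer K} := by
  let q : MvPolynomial (Fin 6) k := X 0 * X 3 - X 1 * X 2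
  have hq : ∀ x : Fin 6 → K, aeval x q = x 0 * x 3 - x 1 * x 2 := fun x => by simp [q]
  have hq0 : q ≠ 0 := fun h => by
    have := congrArg (eval (![1, 0, 0, 1, 0, 0] : Fin 6 → k)) h
    simp [q] at this
  let M : {x : Fin 6 → K // aeval x q ≠ 0} → Matrix.SpecialLinearGroup (Fin 3) K := fun x =>
    ⟨!![(aeval x.1 q)⁻¹, x.1 4, x.1 5; 0, x.1 0, x.1 1; 0, x.1 2, x.1 3], by
      have := mul_inv_cancel₀ x.2
      simp only [det_fin_three, of_apply, cons_val]
      linear_combination this + (aeval x.1 q)⁻¹ * -hq x.1⟩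
  refine isLinearlyDisjointOn_of_parametrization b hq0 s M ?_
    !![1, 0, 0; 0, 0, 0; 0, 0, 0] !![1, X 4, X 5; 0, X 0, X 1; 0, X 2, X 3] ?_
  · ext g
    rw [SetLike.mem_coe, mem_lineStabilizer_iff]
    constructor
    · rintro ⟨x, rfl⟩
      simp [M]
    · rintro ⟨h1, h2⟩
      have hd := g.det_coe
      rw [det_fin_three, h1, h2] at hd
      replace hd : (g 1 1 * g 2 2 - g 1 2 * g 2 1) * g 0 0 = 1 := by
        linear_combination hd
      have hx : aeval ![g 1 1, g 1 2, g 2 1, g 2 2, g 0 1, g 0 2] q =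
        g 1 1 * g 2 2 - g 1 2 * g 2 1 := by simp [hq]
      refine ⟨⟨![g 1 1, g 1 2, g 2 1, g 2 2, g 0 1, g 0 2], ?_⟩, ?_⟩
      · rw [hx]
        exact left_ne_zero_of_mul_eq_one hd
      · ext i j
        simp only [M, hx, inv_eq_of_mul_eq_one_right hd]
        fin_cases i <;> fin_cases j <;> simp [h1, h2]
  · intro x i j
    have := x.2
    fin_cases i <;> fin_cases j <;> simp [M, this]

theorem isZariskiClosed_setOf_entries (I : Set (Fin 3 × Fin 3)) :
    IsZariskiClosed (coordinateRing k K)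
      {g : ExtendedSL3 K | ∀ x ∈ I, g.left x.1 x.2 = 0} := by
  refine ⟨(fun (x : Fin 3 × Fin 3) (g : ExtendedSL3 K) =>
    (g.left : Matrix (Fin 3) (Fin 3) K) x.1 x.2) '' I, ?_, ?_⟩
  · rintro _ ⟨x, -, rfl⟩
    exact subset_regularFunctions _ (entry_mem_coordinateRing x.1 x.2)
  · ext g
    rw [Set.mem_ofPred_eq, Set.mem_ofPred_eq, Set.forall_mem_image]

theorem IsZariskiClosed.inter {X : Type*} {A : Subalgebra k (X → K)} {Z W : Set X}
    (hZ : IsZariskiClosed A Z) (hW : IsZariskiClosed A W) : IsZariskiClosed A (Z ∩ W) := by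
  obtain ⟨S, hS, rfl⟩ := hZ
  obtain ⟨T, hT, rfl⟩ := hW
  refine ⟨S ∪ T, Set.union_subset hS hT, ?_⟩
  ext x
  simp [or_imp, forall_and]

theorem isZariskiClosed_right_eq_one :
    IsZariskiClosed (coordinateRing k K) {g : ExtendedSL3 K | g.right = 1} := by
  classical
  refine ⟨{fun g : ExtendedSL3 K => if g.right = graphElement K then (1 : K) else 0}, ?_, ?_⟩
  · rintro _ rfl
    convert subset_regularFunctions _ (indicator_mem_coordinateRing (k := k) (graphElement K))
  · ext g
    rcases eq_one_or_eq_graphElement g.right with h | h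
    · simp [h, graphElement_ne_one.symm]
    · simp [h, graphElement_ne_one]

theorem isDefinedOver_map_inl (b : Module.Basis ι k K)
    {Q : Subgroup (Matrix.SpecialLinearGroup (Fin 3) K)} (I : Set (Fin 3 × Fin 3))
    (hI : ∀ g, g ∈ Q ↔ ∀ x ∈ I, g x.1 x.2 = 0)
    (h : IsLinearlyDisjointOn (coordinateRing k K) b {g | g.right = 1 ∧ g.left ∈ Q}) :
    IsDefinedOver (coordinateRing k K)
      ((Q.map SemidirectProduct.inl : Subgroup (ExtendedSL3 K)) : Set (ExtendedSL3 K)) := by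
  have e : ((Q.map SemidirectProduct.inl : Subgroup (ExtendedSL3 K)) : Set (ExtendedSL3 K)) =
      {g | g.right = 1 ∧ g.left ∈ Q} := Set.ext fun g => mem_map_inl_iff
  rw [e]
  refine h.isDefinedOver ?_
  convert (isZariskiClosed_right_eq_one (k := k)).inter (isZariskiClosed_setOf_entries I) using 1
  ext g
  simp only [Set.mem_ofPred_eq, Set.mem_inter_iff, hI]

theorem isDefinedOver_borelSubgroup [Infinite K] :
    IsDefinedOver (coordinateRing k K) (borelSubgroup K : Set (ExtendedSL3 K)) :=
  isDefinedOver_map_inl (Module.Basis.ofVectorSpace k K) {(1, 0), (2, 0), (2, 1)}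
    (fun g => by simp [mem_borelSL3_iff]) (isLinearlyDisjointOn_borelSL3 _ _)

theorem isDefinedOver_lineStabilizer [Infinite K] :
    IsDefinedOver (coordinateRing k K)
      ((lineStabilizer K).map SemidirectProduct.inl : Subgroup (ExtendedSL3 K)) :=
  isDefinedOver_map_inl (Module.Basis.ofVectorSpace k K) {(1, 0), (2, 0)}
    (fun g => by simp [mem_lineStabilizer_iff]) (isLinearlyDisjointOn_lineStabilizer _ _)

theorem isDefinedOver_planeStabilizer [Infinite K] :
    IsDefinedOver (coordinateRing k K)
      ((planeStabilizer K).map SemidirectProduct.inl : Subgroup (ExtendedSL3 K)) :=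
  isDefinedOver_map_inl (Module.Basis.ofVectorSpace k K) {(2, 0), (2, 1)}
    (fun g => by simp [mem_planeStabilizer_iff]) (isLinearlyDisjointOn_planeStabilizer _ _)

/-- Both cosets carry the parametrization of `B`, and linear disjointness passes to their union. -/
theorem isDefinedOver_extendedBorel [Infinite K] :
    IsDefinedOver (coordinateRing k K) (extendedBorel K : Set (ExtendedSL3 K)) := by
  have e : (extendedBorel K : Set (ExtendedSL3 K)) =
      {g | g.right = 1 ∧ g.left ∈ borelSL3 K} ∪
        {g | g.right = graphElement K ∧ g.left ∈ borelSL3 K} := by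
    ext g
    simp [mem_extendedBorel_iff, ← or_and_right, eq_one_or_eq_graphElement]
  have h := (isLinearlyDisjointOn_borelSL3 (Module.Basis.ofVectorSpace k K) 1).union
    (isLinearlyDisjointOn_borelSL3 (Module.Basis.ofVectorSpace k K) (graphElement K))
  rw [← e] at h
  refine h.isDefinedOver ?_
  convert isZariskiClosed_setOf_entries (k := k) {(1, 0), (2, 0), (2, 1)} using 1
  ext g
  simp [mem_extendedBorel_iff, mem_borelSL3_iff]

end DefinedOverBaseField

/-! ### Counting the overgroups, complete reducibility and the face order. -/

section CompleteReducibility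

open Matrix

variable {k K : Type*} [Field k] [Field K] [Algebra k K]

theorem lowerSL3_mem_lineStabilizer_iff {x z : K} : lowerSL3 x z ∈ lineStabilizer K ↔ x = 0 := by
  simp [mem_lineStabilizer_iff, coe_lowerSL3]

theorem lowerSL3_mem_planeStabilizer_iff {x z : K} :
    lowerSL3 x z ∈ planeStabilizer K ↔ z = 0 := by
  simp [mem_planeStabilizer_iff, coe_lowerSL3]

theorem lowerSL3_mem_borelSL3_iff {x z : K} : lowerSL3 x z ∈ borelSL3 K ↔ x = 0 ∧ z = 0 := by
  simp [mem_borelSL3_iff, coe_lowerSL3]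

theorem sigma_notMem_map_inl (Q : Subgroup (Matrix.SpecialLinearGroup (Fin 3) K)) :
    sigma K ∉ Q.map SemidirectProduct.inl :=
  fun h => graphElement_ne_one (mem_map_inl_iff.1 h).1

theorem extendedBorel_ne_map_inl (Q : Subgroup (Matrix.SpecialLinearGroup (Fin 3) K)) :
    extendedBorel K ≠ Q.map SemidirectProduct.inl :=
  fun h => sigma_notMem_map_inl Q (h ▸ sigma_mem_extendedBorel)

theorem top_ne_map_inl (Q : Subgroup (Matrix.SpecialLinearGroup (Fin 3) K)) :
    (⊤ : Subgroup (ExtendedSL3 K)) ≠ Q.map SemidirectProduct.inl :=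
  fun h => sigma_notMem_map_inl Q (h ▸ Subgroup.mem_top _)

theorem extendedBorel_ne_top : extendedBorel K ≠ ⊤ := by
  intro h
  have : (SemidirectProduct.inl (lowerSL3 1 0) : ExtendedSL3 K) ∈ extendedBorel K :=
    h ▸ Subgroup.mem_top _
  exact one_ne_zero (lowerSL3_mem_borelSL3_iff.1 this).1

theorem map_inl_inj {Q R : Subgroup (Matrix.SpecialLinearGroup (Fin 3) K)}
    (h : (Q.map SemidirectProduct.inl : Subgroup (ExtendedSL3 K)) =
      R.map SemidirectProduct.inl) : Q = R :=
  Subgroup.map_injective SemidirectProduct.inl_injective h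

theorem lineStabilizer_ne_planeStabilizer : lineStabilizer K ≠ planeStabilizer K := by
  intro h
  have h1 : lowerSL3 (0 : K) 1 ∈ lineStabilizer K := lowerSL3_mem_lineStabilizer_iff.2 rfl
  rw [h, lowerSL3_mem_planeStabilizer_iff] at h1
  exact one_ne_zero h1

theorem lineStabilizer_ne_borelSL3 : lineStabilizer K ≠ borelSL3 K := by
  intro h
  have h1 : lowerSL3 (0 : K) 1 ∈ lineStabilizer K := lowerSL3_mem_lineStabilizer_iff.2 rfl
  rw [h, lowerSL3_mem_borelSL3_iff] at h1
  exact one_ne_zero h1.2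

theorem planeStabilizer_ne_borelSL3 : planeStabilizer K ≠ borelSL3 K := by
  intro h
  have h1 : lowerSL3 (1 : K) 0 ∈ planeStabilizer K := lowerSL3_mem_planeStabilizer_iff.2 rfl
  rw [h, lowerSL3_mem_borelSL3_iff] at h1
  exact one_ne_zero h1.1

theorem extendedBorel_mem_kRParabolics [Infinite K] :
    extendedBorel K ∈ kRParabolics (coordinateRing k K) :=
  ⟨isRParabolic_extendedBorel, isDefinedOver_extendedBorel⟩

theorem borelSubgroup_mem_kRParabolics [Infinite K] :
    borelSubgroup K ∈ kRParabolics (coordinateRing k K) :=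
  ⟨isRParabolic_borelSubgroup, isDefinedOver_borelSubgroup⟩

/-- The `k`-defined R-parabolic subgroups of `SL₃ ⋊ ⟨σ⟩` containing the Borel subgroup. -/
theorem kRParabolicsOver_borelSubgroup [IsAlgClosed K] :
    kRParabolicsOver (coordinateRing k K) (borelSubgroup K) =
      {⊤, extendedBorel K, (lineStabilizer K).map SemidirectProduct.inl,
        (planeStabilizer K).map SemidirectProduct.inl, borelSubgroup K} := by
  ext P
  constructor
  · rintro ⟨⟨hP, -⟩, hB⟩
    rcases eq_of_borelSubgroup_le hB with rfl | rfl | rfl | rfl | rfl | rfl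
    · simp
    · simp
    · simp
    · simp
    · exact absurd hP not_isRParabolic_SL3
    · simp
  · rintro (rfl | rfl | rfl | rfl | rfl)
    · exact ⟨⟨isRParabolic_top, isDefinedOver_univ _⟩, le_top⟩
    · exact ⟨extendedBorel_mem_kRParabolics, borelSubgroup_le_extendedBorel⟩
    · exact ⟨⟨isRParabolic_lineStabilizer, isDefinedOver_lineStabilizer⟩,
        Subgroup.map_mono borelSL3_le_lineStabilizer⟩
    · exact ⟨⟨isRParabolic_planeStabilizer, isDefinedOver_planeStabilizer⟩,
        Subgroup.map_mono borelSL3_le_planeStabilizer⟩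
    · exact ⟨borelSubgroup_mem_kRParabolics, le_rfl⟩

theorem ncard_kRParabolicsOver_borelSubgroup [IsAlgClosed K] :
    (kRParabolicsOver (coordinateRing k K) (borelSubgroup K)).ncard = 5 := by
  rw [kRParabolicsOver_borelSubgroup, Set.ncard_insert_of_notMem, Set.ncard_insert_of_notMem,
    Set.ncard_insert_of_notMem, Set.ncard_pair]
  · exact fun h => planeStabilizer_ne_borelSL3 (map_inl_inj h)
  · rintro (h | h)
    · exact lineStabilizer_ne_planeStabilizer (map_inl_inj h)
    · exact lineStabilizer_ne_borelSL3 (map_inl_inj h)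
  · rintro (h | h | h) <;> exact extendedBorel_ne_map_inl _ h
  · rintro (h | h | h | h)
    · exact extendedBorel_ne_top h.symm
    all_goals exact top_ne_map_inl _ h

/-- The test subgroup is `extendedBorel K` itself: an R-Levi subgroup containing it contains `B`,
which would make this R-parabolic subgroup all of `G`. -/
theorem not_isCompletelyReducibleOver_extendedBorel [IsAlgClosed K] :
    ¬ IsCompletelyReducibleOver (coordinateRing k K) (extendedBorel K) := by
  intro h
  obtain ⟨L, hL, -, hle⟩ := h _ extendedBorel_mem_kRParabolics le_rfl
  exact extendedBorel_ne_top
    (eq_top_of_borelSubgroup_le_isRLevi hL (borelSubgroup_le_extendedBorel.trans hle))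

theorem extendedBorel_notMem_building : extendedBorel K ∉ building k K := by
  rintro ⟨Q, -, -, h⟩
  exact extendedBorel_ne_map_inl Q h

theorem not_isSimplicialComplex_kRParabolics [IsAlgClosed K] :
    ¬ IsSimplicialComplex (kRParabolics (coordinateRing k K))ᵒᵈ := by
  rintro ⟨h, -⟩
  obtain ⟨V, ⟨e⟩⟩ := h (OrderDual.toDual ⟨borelSubgroup K, borelSubgroup_mem_kRParabolics⟩)
  let f : Set.Iic (OrderDual.toDual (⟨borelSubgroup K, borelSubgroup_mem_kRParabolics⟩ :
      kRParabolics (coordinateRing k K))) ≃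
      kRParabolicsOver (coordinateRing k K) (borelSubgroup K) :=
    { toFun := fun P => ⟨(OrderDual.ofDual P.1).1, (OrderDual.ofDual P.1).2, P.2⟩
      invFun := fun P => ⟨OrderDual.toDual ⟨P.1, P.2.1⟩, P.2.2⟩
      left_inv := fun _ => rfl
      right_inv := fun _ => rfl }
  have h5 : Nat.card (Set V) = 5 := by
    rw [← Nat.card_congr e.toEquiv, Nat.card_congr f, Nat.card_coe_set_eq,
      ncard_kRParabolicsOver_borelSubgroup]
  have hfin : Finite (Set V) := Nat.finite_of_card_ne_zero (by omega)
  have hV : Finite V := Finite.of_injective (fun v : V => ({v} : Set V)) Set.singleton_injective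
  have := Fintype.ofFinite V
  rw [Nat.card_eq_fintype_card, Fintype.card_set] at h5
  -- A finite power set has one element or an even number of elements, never five.
  rcases Nat.eq_zero_or_pos (Fintype.card V) with h0 | h0
  · simp [h0] at h5
  · have := dvd_pow_self 2 h0.ne'
    omega

end CompleteReducibility

theorem mainTheorem4 (k K : Type*) [Field k] [Field K] [Algebra k K] [IsAlgClosure k K] :
    (∃ H : Subgroup (ExtendedSL3 K),
      H = Subgroup.closure (insert (sigma K) (borelSubgroup K : Set (ExtendedSL3 K))) ∧
      IsDefinedOver (coordinateRing k K) (H : Set (ExtendedSL3 K)) ∧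
      ¬ IsCompletelyReducibleOver (coordinateRing k K) H ∧
      ¬ (kRParabolicsOver (coordinateRing k K) H ⊆ building k K) ∧
      ¬ (kRParabolicsOver (coordinateRing k K) H \ {⊤} ⊆ building k K)) ∧
    (kRParabolicsOver (coordinateRing k K) (borelSubgroup K)).ncard = 5 ∧
    ¬ IsSimplicialComplex (kRParabolics (coordinateRing k K))ᵒᵈ := by
  have : IsAlgClosed K := IsAlgClosure.isAlgClosed k
  have hmem : extendedBorel K ∈ kRParabolicsOver (coordinateRing k K) (extendedBorel K) :=
    ⟨extendedBorel_mem_kRParabolics, le_rfl⟩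
  exact ⟨⟨extendedBorel K, extendedBorel_eq_closure, isDefinedOver_extendedBorel,
    not_isCompletelyReducibleOver_extendedBorel,
    fun h => extendedBorel_notMem_building (h hmem),
    fun h => extendedBorel_notMem_building (h ⟨hmem, extendedBorel_ne_top⟩)⟩,
    ncard_kRParabolicsOver_borelSubgroup, not_isSimplicialComplex_kRParabolics⟩
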